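/- Let $A>0$ and $\rho=\sqrt{2/(3A)}$. Consider on $\mathbb{R}^6\ni(r_1,P_1,V_1,Q_1,\varepsilon_1,\mathcal{B}_1)$ the system $$r_1'=-\tfrac12 r_1P_1,\quad P_1'=\tfrac32P_1^2+G_1,\quad V_1'=2P_1V_1+\varepsilon_1Q_1,\quad Q_1'=\tfrac32P_1Q_1-\varepsilon_1-r_1^2\varepsilon_1G_1,\quad \varepsilon_1'=\varepsilon_1P_1,\quad \mathcal{B}_1'=2\mathcal{B}_1P_1,$$ where $G_1=A\mathcal{B}_1-A^2V_1-\tfrac1A-r_1^2(\mathcal{B}_1-2AV_1+r_1^2V_1)$. It is the system $u'=p$, $p'=-A+(B+1)u-u^2v$, $v'=\varepsilon q$, $q'=\varepsilon(-Bu+u^2v)$, $\varepsilon'=B'=0$, written (after a rescaling of time, for $r_1>0$) in the chart $$u=A-r_1^2,\quad p=r_1^3P_1,\quad v=\tfrac1A+r_1^4V_1,\quad q=r_1^3Q_1,\quad \varepsilon=r_1^2\varepsilon_1,\quad B=1+r_1^4\mathcal{B}_1 .$$ **1.** The points $E_\pm=(0,\pm\rho,0,0,0,0)$ are isolated equilibria.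 They lie on the line $I=\{r_1=V_1=Q_1=\varepsilon_1=\mathcal{B}_1=0\}$, which is invariant, and they are exchanged by $R:(P_1,Q_1)\mapsto(-P_1,-Q_1)$, a reversing symmetry of the system (the vector field $X$ satisfies $X\circ R=-R\circ X$). The stable manifold of $E_+$ is a smooth submanifold of dimension $1$ and its unstable manifold one of dimension $5$; the unstable manifold of $E_-$ has dimension $1$ and its stable manifold dimension $5$. **2.** The set $$\mathcal{V}_1=\Big\{r_1^2\neq A,\ P_1=0,\ V_1=\tfrac{-(1-A\mathcal{B}_1(A-r_1^2))}{A(A-r_1^2)^2},\ Q_1\in\mathbb{R},\ \varepsilon_1=0,\ \mathcal{B}_1\in\mathbb{R}\Big\}$$ is a smooth three-dimensional submanifold of $\mathbb{R}^6$ consisting of equilibria. (a) The line $\ell_1=\{r_1=0,P_1=0,V_1=-A^{-3},\varepsilon_1=0,\mathcal{B}_1=0\}$ is contained in $\mathcal{V}_1$ and equals $\mathcal{V}_1\cap\{r_1=0,\mathcal{B}_1=0\}$. (b) The chart map is a bijection from $\mathcal{V}_1\cap\{r_1>0\}$ onto the set of all equilibria with $\varepsilon=0$ and $u<A$ of the $(u,p,v,q,\varepsilon,B)$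 system. It restricts to a bijection from the part of $\mathcal{V}_1$ with $r_1>0$, $B>0$ and $u>A/(B+1)$ onto the part with $u<A$ of the critical manifold $S^0=\{\varepsilon=0,\ B>0,\ p=0,\ v=((B+1)u-A)/u^2,\ u>A/(B+1)\}$. (c) Put $\Lambda=\dfrac{2-r_1^2(A-r_1^2)\mathcal{B}_1}{A-r_1^2}$. At each point of $\mathcal{V}_1$ the real eigenvalues of the linearization are $0$ and the real numbers $\mu$ with $\mu^2=\Lambda$. Over each point $x\in\mathcal{V}_1$ with $\Lambda>0$ there are one-dimensional stable and unstable fibers: in arbitrarily small open neighbourhoods $U$ of $x$, the set of initial values of the solutions that stay in $U$ for all forward (respectively backward) time and converge to $x$ exponentially fast is a smooth one-dimensional submanifold through $x$, whose tangent space at $x$ is the eigenspace of the linearization for $-\sqrt\Lambda$ (respectively $\sqrt\Lambda$). In (b), the points with $\Lambda>0$ of the part of $\mathcal{V}_1$ that corresponds to $S^0\cap\{u<A\}$ are exactly those that correspond to the saddle sheet $\big\{0<v<\tfrac{(1+B)^2}{4A},\ u=\tfrac{1+B-\sqrt{(1+B)^2-4Av}}{2v}\big\}$ of $S^0$. (d)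 Over each point $x\in\mathcal{V}_1$ with $\Lambda\ne0$ there is a one-dimensional neutral fiber $N_x=\operatorname{span}\{(0,Q_1(A-r_1^2)^2,0,0,\Lambda,0)\}$: the tangent space $T_x\mathcal{V}_1$ is three-dimensional and contained in the kernel of the linearization $L$, and the generalized eigenspace of $L$ for the eigenvalue $0$ is $T_x\mathcal{V}_1\oplus N_x$. The linearized dynamics on the fiber is non-exponential: $e^{tL}w=w+tLw$ with $Lw\in T_x\mathcal{V}_1$ for all $w\in N_x$ and $t\in\mathbb{R}$. Unless $x$ is one of the two points $\mathbf{p}_\pm=\big(0,0,-A^{-3},\mp\tfrac{2}{\sqrt{3A^3}},0,0\big)$, one has $\ker L=T_x\mathcal{V}_1$ and $Lw\neq0$ for $0\ne w\in N_x$, so that the fiber comes from a nontrivial Jordan block; at $\mathbf{p}_\pm$, $\ker L=T_x\mathcal{V}_1\oplus N_x$. -/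

import Mathlib

open Set Filter Topology
open scoped ContDiff

/-! ### Generic notions for autonomous ODEs on `ℝ⁶` -/

/-- The six-dimensional space. All notions below (topology, smoothness, exponential convergence)
are independent of the choice of norm. -/
abbrev Space6 : Type := Fin 6 → ℝ

/-- `γ` solves `γ' = X(γ)` on the set of times `J`. -/
def IsSolutionOn (X : Space6 → Space6) (γ : ℝ → Space6) (J : Set ℝ) : Prop :=
  ∀ t ∈ J, HasDerivWithinAt γ (X (γ t)) J t

/-- `p` is an equilibrium that is isolated in the set of all equilibria of `X`. -/
def IsIsolatedEquilibrium (X : Space6 → Space6) (p : Space6) : Prop :=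
  X p = 0 ∧ ∀ᶠ x in 𝓝[≠] p, X x ≠ 0

/-- `S` is invariant: a solution on any interval of times which meets `S` stays in `S`. -/
def IsInvariantSet (X : Space6 → Space6) (S : Set Space6) : Prop :=
  ∀ (γ : ℝ → Space6) (J : Set ℝ), J.OrdConnected → IsSolutionOn X γ J →
    ∀ s ∈ J, γ s ∈ S → ∀ t ∈ J, γ t ∈ S

/-- The (global) stable manifold of an equilibrium `p`: the initial values of the solutions that
exist for all forward time and converge to `p`. -/
def stableManifold (X : Space6 → Space6) (p : Space6) : Set Space6 :=
  {x | ∃ γ : ℝ → Space6, γ 0 = x ∧ IsSolutionOn X γ (Ici 0) ∧ Tendsto γ atTop (𝓝 p)}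

/-- The (global) unstable manifold of an equilibrium `p`: the initial values of the solutions that
exist for all backward time and converge to `p` in backward time. -/
def unstableManifold (X : Space6 → Space6) (p : Space6) : Set Space6 :=
  {x | ∃ γ : ℝ → Space6, γ 0 = x ∧ IsSolutionOn X γ (Iic 0) ∧ Tendsto γ atBot (𝓝 p)}

/-- The local stable fiber, in `U`, over a (not necessarily isolated) equilibrium `p`: the initial
values of the solutions that stay in `U` for all forward time and converge to `p` at an
exponential rate. -/
def localStableFiber (X : Space6 → Space6) (p : Space6) (U : Set Space6) : Set Space6 :=
  {x | ∃ γ : ℝ → Space6, γ 0 = x ∧ IsSolutionOn X γ (Ici 0) ∧ (∀ t ∈ Ici (0 : ℝ), γ t ∈ U) ∧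
    ∃ C > 0, ∃ μ > 0, ∀ t ∈ Ici (0 : ℝ), ‖γ t - p‖ ≤ C * Real.exp (-μ * t)}

/-- The local unstable fiber, in `U`, over an equilibrium `p`: as `localStableFiber`, in backward
time. -/
def localUnstableFiber (X : Space6 → Space6) (p : Space6) (U : Set Space6) : Set Space6 :=
  {x | ∃ γ : ℝ → Space6, γ 0 = x ∧ IsSolutionOn X γ (Iic 0) ∧ (∀ t ∈ Iic (0 : ℝ), γ t ∈ U) ∧
    ∃ C > 0, ∃ μ > 0, ∀ t ∈ Iic (0 : ℝ), ‖γ t - p‖ ≤ C * Real.exp (μ * t)}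

/-- `S` is a (nonempty) embedded `C^∞` submanifold of `ℝ⁶` of dimension `k`: near each of its
points, a local `C^∞` diffeomorphism of `ℝ⁶` straightens it to a `k`-dimensional subspace. -/
def IsSmoothSubmanifold (k : ℕ) (S : Set Space6) : Prop :=
  S.Nonempty ∧ ∀ x ∈ S, ∃ (Φ : OpenPartialHomeomorph Space6 Space6) (W : Submodule ℝ Space6),
    Module.finrank ℝ W = k ∧ x ∈ Φ.source ∧
    ContDiffOn ℝ ∞ Φ Φ.source ∧ ContDiffOn ℝ ∞ Φ.symm Φ.target ∧
    Φ '' (S ∩ Φ.source) = (W : Set Space6) ∩ Φ.target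

/-- The velocities at `x` of the curves that run in `S` (the tangent space at `x`, if `S` is a
submanifold). -/
def tangentVectors (S : Set Space6) (x : Space6) : Set Space6 :=
  {w | ∃ c : ℝ → Space6, c 0 = x ∧ HasDerivAt c w 0 ∧ ∀ᶠ t in 𝓝 0, c t ∈ S}

/-- The Jacobian of the vector field `X` at `p`, as an endomorphism of `ℝ⁶`. -/
noncomputable def jacobian (X : Space6 → Space6) (p : Space6) : Module.End ℝ Space6 :=
  (fderiv ℝ X p).toLinearMap

/-! ### The system in the entry/exit chart

The coordinates `(x 0, …, x 5)` are `(r₁, P₁, V₁, Q₁, ε₁, ℬ₁)`. -/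

/-- The function `F₁ = ℬ₁ - 2AV₁ + r₁²V₁`. -/
def chartF (A : ℝ) (x : Space6) : ℝ :=
  x 5 - 2 * A * x 2 + x 0 ^ 2 * x 2

/-- The expression `Aℬ₁ - A²V₁ - 1/A - r₁²F₁`. -/
noncomputable def chartG (A : ℝ) (x : Space6) : ℝ :=
  A * x 5 - A ^ 2 * x 2 - 1 / A - x 0 ^ 2 * chartF A x

/-- The vector field of the six-dimensional system in the chart `K₁`. -/
noncomputable def chartField (A : ℝ) (x : Space6) : Space6 :=
  ![-(1 / 2) * x 0 * x 1,
    3 / 2 * x 1 ^ 2 + chartG A x,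
    2 * x 1 * x 2 + x 4 * x 3,
    3 / 2 * x 1 * x 3 - x 4 - x 0 ^ 2 * x 4 * chartG A x,
    x 4 * x 1,
    2 * x 5 * x 1]

/-- `ρ = √(2/(3A))`. -/
noncomputable def rho (A : ℝ) : ℝ := √(2 / (3 * A))

/-- The equilibrium `E₊`. -/
noncomputable def Eplus (A : ℝ) : Space6 := ![0, rho A, 0, 0, 0, 0]

/-- The equilibrium `E₋`. -/
noncomputable def Eminus (A : ℝ) : Space6 := ![0, -rho A, 0, 0, 0, 0]

/-- The reflection `(P₁, Q₁) ↦ (-P₁, -Q₁)`. -/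
def reflection (x : Space6) : Space6 := ![x 0, -x 1, x 2, -x 3, x 4, x 5]

/-- The line `I`, the `P₁`-axis. -/
def lineI : Set Space6 := {x | x 0 = 0 ∧ x 2 = 0 ∧ x 3 = 0 ∧ x 4 = 0 ∧ x 5 = 0}

/-- The set `𝒱₁`. The formula for `V₁` needs `r₁² ≠ A`. -/
def manifoldV1 (A : ℝ) : Set Space6 :=
  {x | x 0 ^ 2 ≠ A ∧ x 1 = 0 ∧
    x 2 = -(1 - A * x 5 * (A - x 0 ^ 2)) / (A * (A - x 0 ^ 2) ^ 2) ∧ x 4 = 0}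

/-- The line `ℓ₁`. -/
def lineL1 (A : ℝ) : Set Space6 :=
  {x | x 0 = 0 ∧ x 1 = 0 ∧ x 2 = -1 / A ^ 3 ∧ x 4 = 0 ∧ x 5 = 0}

/-- The points `p₊` (for `s = 1`) and `p₋` (for `s = -1`) of `ℓ₁`. -/
noncomputable def pointP (A s : ℝ) : Space6 :=
  ![0, 0, -1 / A ^ 3, -s * (2 / √(3 * A ^ 3)), 0, 0]

/-- `Λ = (2 - r₁²(A - r₁²)ℬ₁)/(A - r₁²)`, the square of the nonzero eigenvalues on `𝒱₁`. -/
noncomputable def Lam (A : ℝ) (x : Space6) : ℝ :=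
  (2 - x 0 ^ 2 * (A - x 0 ^ 2) * x 5) / (A - x 0 ^ 2)

/-- The neutral fiber over a point of `𝒱₁`, spanned by `(0, Q₁(A - r₁²)², 0, 0, Λ, 0)`. -/
noncomputable def neutralFiber (A : ℝ) (x : Space6) : Submodule ℝ Space6 :=
  Submodule.span ℝ {(![0, x 3 * (A - x 0 ^ 2) ^ 2, 0, 0, Lam A x, 0] : Space6)}

/-! ### The critical manifold in the original coordinates

The original coordinates `(y 0, …, y 5)` are `(u, p, v, q, ε, B)`. -/

/-- The chart map `K₁ → {u < A}`: `u = A - r₁²`, `p = r₁³P₁`, `v = 1/A + r₁⁴V₁`, `q = r₁³Q₁`,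
`ε = r₁²ε₁`, `B = 1 + r₁⁴ℬ₁`. -/
noncomputable def blowDown (A : ℝ) (x : Space6) : Space6 :=
  ![A - x 0 ^ 2, x 0 ^ 3 * x 1, 1 / A + x 0 ^ 4 * x 2, x 0 ^ 3 * x 3, x 0 ^ 2 * x 4,
    1 + x 0 ^ 4 * x 5]

/-- The right-hand side of the spatial ODE `u' = p`, `p' = -A + (B+1)u - u²v`, `v' = εq`,
`q' = ε(-Bu + u²v)`, extended by `ε' = 0` and `B' = 0`. -/
def spatialField (A : ℝ) (y : Space6) : Space6 :=
  ![y 1,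
    -A + (y 5 + 1) * y 0 - y 0 ^ 2 * y 2,
    y 4 * y 3,
    y 4 * (-y 5 * y 0 + y 0 ^ 2 * y 2),
    0,
    0]

/-- All equilibria of the spatial ODE at `ε = 0`. -/
def layerEquilibria (A : ℝ) : Set Space6 := {y | y 4 = 0 ∧ spatialField A y = 0}

/-- The critical manifold `S⁰` (over all parameter values `B > 0`). -/
def criticalManifold (A : ℝ) : Set Space6 :=
  {y | y 4 = 0 ∧ 0 < y 5 ∧ y 1 = 0 ∧ y 2 = ((y 5 + 1) * y 0 - A) / y 0 ^ 2 ∧ A / (y 5 + 1) < y 0}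

/-- The saddle sheet of `S⁰`: `p = 0`, `u = u_s(v)`, `0 < v < (1+B)²/(4A)`. -/
def saddleSheet (A : ℝ) : Set Space6 :=
  {y | y 4 = 0 ∧ 0 < y 5 ∧ y 1 = 0 ∧ 0 < y 2 ∧ y 2 < (1 + y 5) ^ 2 / (4 * A) ∧
    y 0 = (1 + y 5 - √((1 + y 5) ^ 2 - 4 * A * y 2)) / (2 * y 2)}

/-! ### Scalar differential inequalities -/

/-! No general invariant manifold theorem is needed: the system is triangular enough for every
stable set to be found directly. Along a solution each of r₁, ε₁, ℬ₁, and once ε₁ = 0 also V₁ and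
Q₁, solves a scalar equation y' = κP₁y with constant κ. Unstable sets follow from stable ones
through the reversing symmetry.

At E₊ one has P₁ → ρ > 0, so every coordinate except r₁ is repelled and must sit at its limit
(`eq_zero_of_tendsto_of_eventually_nonneg`); the stable manifold is a line parallel to the r₁-axis
(`stableManifold_Eplus`). At E₋ only r₁ is repelled, so the stable manifold lies in r₁ = 0.
Reversing the sign of the r₁-rate turns E₋ into a sink without changing the field on that
hyperplane. A quadratic Lyapunov function makes the basin of this sink open
(`isOpen_stableManifold_attractedField`), and the stable manifold is the hyperplane intersected with
this open set.

𝒱₁ is a graph over (r₁, Q₁, ℬ₁), and the Jacobian on it is explicit because P₁ = ε₁ = G₁ = 0 there.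
An eigenvector for a nonzero eigenvalue is determined by its P₁-entry, and the P₁-row then reads μ²
= Λ. The generalized kernel is cut out by two linear equations and is stable under preimages by L
(`mem_sup_of_jacobian_mem_sup`).

Stable fibers are also explicit. Exponential convergence makes P₁ integrable in time, so ε₁' = ε₁P₁
and ε₁ → 0 force ε₁ = 0. With σ' = P₁σ/2 and σ → 1, the remaining coordinates are r₁ = r₁(x)/σ, V₁ =
V₁(x)σ⁴, Q₁ = Q₁(x)σ³, ℬ₁ = ℬ₁(x)σ⁴. As a function of σ, P₁² solves the linear equation d(P₁²)/dσ =
(6P₁² + 4G₁)/σ. Its solution vanishing at σ = 1 has a double root there and equals (σ - σ³)²M(σ)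
with M(1) = Λ. The branch P₁ = (σ - σ³)√M is the attracting one. `fiberCurve_mem_localStableFiber`
and `eq_fiberCurve_of_mem_localStableFiber` show that, in suitable neighbourhoods, the stable fiber
is exactly this curve. -/

theorem eq_zero_of_hasDerivWithinAt_mul_Icc {y a : ℝ → ℝ} {s t : ℝ} (hst : s ≤ t)
    (ha : ContinuousOn a (Icc s t))
    (hy : ∀ u ∈ Icc s t, HasDerivWithinAt y (a u * y u) (Icc s t) u) (h0 : y s = 0) : y t = 0 := by
  obtain ⟨M, hM⟩ := isCompact_Icc.exists_bound_of_continuousOn ha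
  refine eq_zero_of_abs_deriv_le_mul_abs_self_of_eq_zero_right (f := y) (f' := fun u => a u * y u)
    (K := M) (fun u hu => (hy u hu).continuousWithinAt) (fun u hu => ?_) h0 (fun u hu => ?_) t
    ⟨hst, le_rfl⟩
  · exact (hy u (Ico_subset_Icc_self hu)).mono_of_mem_nhdsWithin (Icc_mem_nhdsGE_of_mem hu)
  · rw [norm_mul]
    exact mul_le_mul_of_nonneg_right (hM u (Ico_subset_Icc_self hu)) (norm_nonneg _)

/-- A solution of a scalar linear homogeneous equation which vanishes somewhere vanishes
everywhere. -/
theorem eq_zero_of_hasDerivWithinAt_mul {y a : ℝ → ℝ} {J : Set ℝ} (hJ : J.OrdConnected)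
    (ha : ContinuousOn a J) (hy : ∀ u ∈ J, HasDerivWithinAt y (a u * y u) J u) {s : ℝ}
    (hs : s ∈ J) (h0 : y s = 0) : ∀ t ∈ J, y t = 0 := by
  intro t ht
  rcases le_total s t with hst | hst
  · have hsub : Icc s t ⊆ J := hJ.out hs ht
    exact eq_zero_of_hasDerivWithinAt_mul_Icc hst (ha.mono hsub)
      (fun u hu => (hy u (hsub hu)).mono hsub) h0
  · have hsub : Icc t s ⊆ J := hJ.out ht hs
    have hmaps : MapsTo (fun u : ℝ => -u) (Icc (-s) (-t)) (Icc t s) := fun u hu =>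
      ⟨by linarith [hu.2], by linarith [hu.1]⟩
    have h := eq_zero_of_hasDerivWithinAt_mul_Icc (y := fun u => y (-u)) (a := fun u => -a (-u))
      (neg_le_neg hst) ((ha.mono hsub).comp continuousOn_neg hmaps).neg (fun u hu => ?_)
      (by simpa using h0)
    · simpa using h
    · have h1 := ((hy (-u) (hsub (hmaps hu))).mono hsub).scomp u (hasDerivWithinAt_neg u _) hmaps
      refine h1.congr_deriv ?_
      simp

theorem le_of_tendsto_of_deriv_nonneg {f f' : ℝ → ℝ} {T L : ℝ}
    (hf : ∀ t ∈ Ici T, HasDerivWithinAt f (f' t) (Ici T) t) (hf' : ∀ t ∈ Ici T, 0 ≤ f' t)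
    (hL : Tendsto f atTop (𝓝 L)) : ∀ t ∈ Ici T, f t ≤ L := by
  have hmono : MonotoneOn f (Ici T) :=
    monotoneOn_of_hasDerivWithinAt_nonneg (convex_Ici T) (fun t ht => (hf t ht).continuousWithinAt)
      (fun t ht => (hf t (interior_subset ht)).mono interior_subset)
      (fun t ht => hf' t (interior_subset ht))
  intro t ht
  refine ge_of_tendsto hL ?_
  filter_upwards [eventually_ge_atTop t] with u hu
  exact hmono ht (le_trans (mem_Ici.1 ht) hu) hu

theorem eq_of_tendsto_of_deriv_eq_zero {f : ℝ → ℝ} {T L : ℝ}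
    (hf : ∀ t ∈ Ici T, HasDerivWithinAt f 0 (Ici T) t) (hL : Tendsto f atTop (𝓝 L)) :
    ∀ t ∈ Ici T, f t = L := by
  intro t ht
  refine le_antisymm (le_of_tendsto_of_deriv_nonneg (f' := fun _ => 0) hf (by simp) hL t ht) ?_
  have := le_of_tendsto_of_deriv_nonneg (f := fun t => -f t) (f' := fun _ => 0) (T := T)
    (fun t ht => (hf t ht).neg.congr_deriv neg_zero) (fun _ _ => le_rfl) hL.neg t ht
  linarith

/-- If `D' = cD` with a coefficient that is eventually nonnegative, and `D → 0`, then `D = 0`. -/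
theorem eq_zero_of_tendsto_of_eventually_nonneg {D c : ℝ → ℝ}
    (hD : ∀ t ∈ Ici (0 : ℝ), HasDerivWithinAt D (c t * D t) (Ici 0) t)
    (hc : ContinuousOn c (Ici 0)) (hpos : ∀ᶠ t in atTop, 0 ≤ c t)
    (hL : Tendsto D atTop (𝓝 0)) : ∀ t ∈ Ici (0 : ℝ), D t = 0 := by
  obtain ⟨T₀, hT₀⟩ := eventually_atTop.1 hpos
  set T := max T₀ 0
  have hT : Ici T ⊆ Ici (0 : ℝ) := Ici_subset_Ici.2 (le_max_right _ _)
  -- D² is nondecreasing on [T, ∞) and tends to 0, hence is at most 0 there. Uniqueness for the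
  -- linear equation then carries the zero at T back to all t ≥ 0.
  have hzero : D T = 0 := by
    have h := le_of_tendsto_of_deriv_nonneg (f := fun t => D t ^ 2)
      (f' := fun t => 2 * c t * D t ^ 2) (T := T) (L := 0)
      (fun t ht => (((hD t (hT ht)).mono hT).pow 2).congr_deriv (by ring))
      (fun t ht => by
        have := hT₀ t (le_trans (le_max_left _ _) ht)
        positivity)
      (by simpa using hL.pow 2) T self_mem_Ici
    exact pow_eq_zero_iff two_ne_zero |>.1 (le_antisymm h (sq_nonneg _))
  exact eq_zero_of_hasDerivWithinAt_mul ordConnected_Ici hc hD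
    (mem_Ici.2 (le_max_right T₀ 0)) hzero

/-- If `y' = Py` with `P` exponentially small, and `y → 0`, then `y = 0`. -/
theorem eq_zero_of_tendsto_of_exp_small {y P : ℝ → ℝ} {C μ : ℝ} (hμ : 0 < μ)
    (hy : ∀ t ∈ Ici (0 : ℝ), HasDerivWithinAt y (P t * y t) (Ici 0) t)
    (hP : ∀ t ∈ Ici (0 : ℝ), |P t| ≤ C * Real.exp (-μ * t))
    (hL : Tendsto y atTop (𝓝 0)) : ∀ t ∈ Ici (0 : ℝ), y t = 0 := by
  -- Integrating factor with logarithmic derivative 2C e^(-μt), which dominates -2P. Multiplied by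
  -- it, y² becomes nondecreasing; the factor tends to 1, so the product still tends to 0.
  have hE : ∀ t, HasDerivAt (fun t => Real.exp (-(2 * C / μ) * Real.exp (-μ * t)))
      (2 * C * Real.exp (-μ * t) * Real.exp (-(2 * C / μ) * Real.exp (-μ * t))) t := by
    intro t
    have h1 : HasDerivAt (fun t : ℝ => -μ * t) (-μ) t := by
      simpa using (hasDerivAt_id t).const_mul (-μ)
    refine ((h1.exp.const_mul (-(2 * C / μ))).exp).congr_deriv ?_
    field_simp
  have hlim : Tendsto (fun t => y t ^ 2 * Real.exp (-(2 * C / μ) * Real.exp (-μ * t))) atTop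
      (𝓝 0) := by
    have h1 : Tendsto (fun t : ℝ => Real.exp (-μ * t)) atTop (𝓝 0) :=
      Real.tendsto_exp_atBot.comp (tendsto_id.const_mul_atTop_of_neg (by linarith))
    have h2 := (hL.pow 2).mul ((Real.continuous_exp.tendsto _).comp (h1.const_mul (-(2 * C / μ))))
    simpa using h2
  intro t ht
  have h := le_of_tendsto_of_deriv_nonneg (T := 0)
    (fun t ht => ((hy t ht).pow 2).mul (hE t).hasDerivWithinAt)
    (fun t ht => ?_) hlim t ht
  · have hpos := Real.exp_pos (-(2 * C / μ) * Real.exp (-μ * t))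
    have : y t ^ 2 ≤ 0 := by
      by_contra hcon
      exact absurd h (not_le.2 (mul_pos (not_le.1 hcon) hpos))
    exact pow_eq_zero_iff two_ne_zero |>.1 (le_antisymm this (sq_nonneg _))
  · have h1 := (abs_le.1 (hP t ht)).1
    have hpos := Real.exp_pos (-(2 * C / μ) * Real.exp (-μ * t))
    have : 0 ≤ 2 * y t ^ 2 * (P t + C * Real.exp (-μ * t)) *
        Real.exp (-(2 * C / μ) * Real.exp (-μ * t)) :=
      mul_nonneg (mul_nonneg (by positivity) (by linarith)) hpos.le
    refine this.trans (le_of_eq ?_)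
    simp only [Nat.cast_ofNat, Nat.add_one_sub_one, pow_one, Pi.pow_apply]
    ring

/-- If `ℓ' ≤ -cℓ` wherever `ℓ < η`, and `0 ≤ ℓ(T) < η`, then `ℓ` stays below `η` and decays. -/
theorem le_mul_exp_of_deriv_le {ℓ ℓ' : ℝ → ℝ} {T η c : ℝ} (hc : 0 < c)
    (hℓ : ∀ t ∈ Ici T, HasDerivWithinAt ℓ (ℓ' t) (Ici T) t)
    (hdec : ∀ t ∈ Ici T, ℓ t < η → ℓ' t ≤ -c * ℓ t) (h0 : 0 ≤ ℓ T) (hT : ℓ T < η) :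
    ∀ t ∈ Ici T, ℓ t < η ∧ ℓ t ≤ η * Real.exp (-(c / 2) * (t - T)) := by
  -- The midpoint makes the barrier positive even if ℓ(T) = 0 and keeps it below η, where the
  -- differential inequality is available. Its rate c/2 < c gives the strict inequality needed at a
  -- contact point.
  set b := (ℓ T + η) / 2 with hb
  have hbpos : 0 < b := by rw [hb]; linarith
  have hbη : b < η := by rw [hb]; linarith
  have hB : ∀ t, HasDerivAt (fun t => b * Real.exp (-(c / 2) * (t - T)))
      (-(c / 2) * (b * Real.exp (-(c / 2) * (t - T)))) t := by
    intro t
    have h1 : HasDerivAt (fun t : ℝ => -(c / 2) * (t - T)) (-(c / 2)) t := by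
      simpa using ((hasDerivAt_id t).sub_const T).const_mul (-(c / 2))
    exact (h1.exp.const_mul b).congr_deriv (by ring)
  have hexp : ∀ t ∈ Ici T, Real.exp (-(c / 2) * (t - T)) ≤ 1 := fun t ht =>
    Real.exp_le_one_iff.2 (by nlinarith [mem_Ici.1 ht])
  have key : ∀ t ∈ Ici T, ℓ t ≤ b * Real.exp (-(c / 2) * (t - T)) := by
    intro t ht
    refine image_le_of_deriv_right_lt_deriv_boundary (f := ℓ) (f' := ℓ') (a := T) (b := t)
      (fun u hu => (hℓ u hu.1).continuousWithinAt.mono Icc_subset_Ici_self)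
      (fun u hu => (hℓ u hu.1).mono (Ici_subset_Ici.2 hu.1))
      (by simp [hb]; linarith) hB (fun u hu heq => ?_) ⟨ht, le_rfl⟩
    have hpos : 0 < b * Real.exp (-(c / 2) * (u - T)) := by positivity
    have hlt : ℓ u < η := by
      rw [heq]; nlinarith [hexp u hu.1]
    have := hdec u hu.1 hlt
    rw [← heq] at hpos ⊢
    nlinarith
  intro t ht
  refine ⟨(key t ht).trans_lt ?_, (key t ht).trans ?_⟩
  · nlinarith [hexp t ht]
  · exact mul_le_mul_of_nonneg_right hbη.le (Real.exp_pos _).le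

/-! ### Global solutions of bounded Lipschitz fields -/

/-- Speed at most M confines a solution on [0, n] to a ball of radius Mn, so Picard–Lindelöf applies
on each [0, n] without a smallness condition; uniqueness glues the pieces. -/
theorem exists_solution_Ici_of_lipschitzWith {E : Type*} [NormedAddCommGroup E] [NormedSpace ℝ E]
    [CompleteSpace E] {F : E → E} {K : NNReal} (hK : LipschitzWith K F) {M : NNReal}
    (hM : ∀ x, ‖F x‖ ≤ M) (x : E) :
    ∃ γ : ℝ → E, γ 0 = x ∧ ∀ t ∈ Ici (0 : ℝ), HasDerivWithinAt γ (F (γ t)) (Ici 0) t := by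
  have hex : ∀ n : ℕ, ∃ γ : ℝ → E, γ 0 = x ∧
      ∀ t ∈ Icc (0 : ℝ) n, HasDerivWithinAt γ (F (γ t)) (Icc 0 n) t := by
    intro n
    have hp : IsPicardLindelof (fun _ => F) (⟨0, le_rfl, n.cast_nonneg⟩ : Icc (0 : ℝ) n) x
        (M * n) 0 M K :=
      IsPicardLindelof.of_time_independent (fun y _ => hM y) hK.lipschitzOnWith (by simp)
    exact hp.exists_eq_forall_mem_Icc_hasDerivWithinAt₀
  choose γ h0 hγ using hex
  have hagree : ∀ m n : ℕ, m ≤ n → ∀ t ∈ Icc (0 : ℝ) m, γ m t = γ n t := by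
    intro m n hmn t ht
    have hsub : Icc (0 : ℝ) m ⊆ Icc 0 n := Icc_subset_Icc_right (by exact_mod_cast hmn)
    refine ODE_solution_unique_of_mem_Icc_right (v := fun _ => F) (s := fun _ => univ) (K := K)
      (fun _ _ => hK.lipschitzOnWith) (fun u hu => (hγ m u hu).continuousWithinAt)
      (fun u hu => (hγ m u (Ico_subset_Icc_self hu)).mono_of_mem_nhdsWithin
        (Icc_mem_nhdsGE_of_mem hu)) (fun _ _ => mem_univ _)
      (fun u hu => (hγ n u (hsub hu)).continuousWithinAt.mono hsub)
      (fun u hu => ((hγ n u (hsub (Ico_subset_Icc_self hu))).mono hsub).mono_of_mem_nhdsWithin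
        (Icc_mem_nhdsGE_of_mem hu)) (fun _ _ => mem_univ _) (by rw [h0, h0]) ht
  set Γ : ℝ → E := fun t => γ (⌈t⌉₊) t
  have hΓ : ∀ n : ℕ, ∀ t ∈ Icc (0 : ℝ) n, Γ t = γ n t := fun n t ht =>
    hagree _ n (Nat.ceil_le.2 ht.2) t ⟨ht.1, Nat.le_ceil t⟩
  refine ⟨Γ, (hΓ 0 0 (by simp)).trans (h0 0), fun t ht => ?_⟩
  -- The extra 1 puts t strictly below n, so that a derivative within [0, n] is one within [0, ∞).
  set n := ⌈t⌉₊ + 1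
  have htn : t < n := by
    have := Nat.le_ceil t
    push_cast [n]
    linarith
  have hmem : t ∈ Icc (0 : ℝ) n := ⟨ht, htn.le⟩
  have h1 : HasDerivWithinAt Γ (F (Γ t)) (Icc 0 n) t := by
    rw [hΓ n t hmem]
    exact (hγ n t hmem).congr (hΓ n) (hΓ n t hmem)
  refine h1.mono_of_mem_nhdsWithin ?_
  rw [← Ici_inter_Iic]
  exact inter_mem self_mem_nhdsWithin (mem_nhdsWithin_of_mem_nhds (Iic_mem_nhds htn))

/-! ### Basins of attraction -/

/-- Coordinatewise truncation to the cube `[-R, R]⁶`. -/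
def clampCube (R : ℝ) (x : Space6) : Space6 := fun i => max (-R) (min R (x i))

theorem lipschitzWith_clampCube (R : ℝ) : LipschitzWith 1 (clampCube R) := by
  refine LipschitzWith.of_dist_le_mul fun x y => ?_
  rw [NNReal.coe_one, one_mul, dist_pi_le_iff dist_nonneg]
  intro i
  have h : LipschitzWith 1 (fun s : ℝ => max (-R) (min R s)) :=
    (LipschitzWith.id.const_min R).const_max (-R)
  have := h.dist_le_mul (x i) (y i)
  rw [NNReal.coe_one, one_mul] at this
  exact this.trans (dist_le_pi_dist x y i)

theorem clampCube_mem {R : ℝ} (hR : 0 ≤ R) (x : Space6) :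
    clampCube R x ∈ Metric.closedBall (0 : Space6) R := by
  rw [mem_closedBall_zero_iff, pi_norm_le_iff_of_nonneg hR]
  intro i
  rw [Real.norm_eq_abs, abs_le]
  exact ⟨le_max_left _ _, max_le (by linarith) (min_le_left _ _)⟩

theorem clampCube_eq_self {R : ℝ} {x : Space6} (hx : ‖x‖ ≤ R) : clampCube R x = x := by
  funext i
  have h := abs_le.1 ((norm_le_pi_norm x i).trans hx)
  simp only [clampCube]
  rw [min_eq_right h.2, max_eq_right h.1]

/-- The basin of attraction of an equilibrium with a strict quadratic-type Lyapunov function is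
open. -/
theorem isOpen_stableManifold_of_lyapunov {X : Space6 → Space6} (hX : ContDiff ℝ 1 X)
    {p : Space6} {L : Space6 → ℝ} (hL : Differentiable ℝ L) (hLp : L p = 0) {m η c : ℝ}
    (hm : 0 < m) (hη : 0 < η) (hc : 0 < c) (hLm : ∀ x, m * ‖x - p‖ ^ 2 ≤ L x)
    (hdec : ∀ x, L x < η → fderiv ℝ L x (X x) ≤ -c * L x) :
    IsOpen (stableManifold X p) := by
  rw [isOpen_iff_mem_nhds]
  rintro x₀ ⟨γ₀, h0, hsol, hlim⟩
  have hLlim : Tendsto (fun t => L (γ₀ t)) atTop (𝓝 0) := by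
    rw [← hLp]
    exact (hL.continuous.tendsto p).comp hlim
  obtain ⟨T, hTη, hT0⟩ := ((hLlim.eventually_lt_const hη).and (eventually_ge_atTop 0)).exists
  have hcont : ContinuousOn γ₀ (Icc 0 T) := fun t ht =>
    (hsol t ht.1).continuousWithinAt.mono Icc_subset_Ici_self
  obtain ⟨R₁, hR₁⟩ := isCompact_Icc.exists_bound_of_continuousOn hcont
  have hsub : ∀ x, L x < η → ‖x‖ ≤ ‖p‖ + √(η / m) := by
    intro x hx
    have h1 : ‖x - p‖ ≤ √(η / m) := by
      refine Real.le_sqrt_of_sq_le ?_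
      rw [le_div_iff₀ hm]
      linarith [hLm x]
    calc ‖x‖ = ‖p + (x - p)‖ := by congr 1; abel
      _ ≤ _ := (norm_add_le _ _).trans (by linarith)
  -- The cube contains the 1-neighbourhood of the reference orbit on [0, T] and the whole sublevel
  -- set L < η.
  set R := max (R₁ + 1) (‖p‖ + √(η / m))
  have hR : 0 ≤ R := le_trans (by positivity) (le_max_right _ _)
  have hcpt : IsCompact (Metric.closedBall (0 : Space6) R) := isCompact_closedBall _ _
  obtain ⟨K, hK⟩ := (hX.contDiffOn (s := Metric.closedBall (0 : Space6) R)).exists_lipschitzOnWith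
    one_ne_zero (convex_closedBall _ _) hcpt
  obtain ⟨M, hM⟩ := hcpt.exists_bound_of_continuousOn hX.continuous.continuousOn
  -- The truncated field is bounded and globally Lipschitz, so its solutions are global. It agrees
  -- with X on the cube, which is a ball of the sup norm.
  set F : Space6 → Space6 := fun x => X (clampCube R x)
  have hF : LipschitzWith K F := by
    have := hK.comp (lipschitzWith_clampCube R).lipschitzOnWith
      (fun x (_ : x ∈ univ) => clampCube_mem hR x)
    rw [mul_one, lipschitzOnWith_univ] at this
    exact this
  have hFX : ∀ x, ‖x‖ ≤ R → F x = X x := fun x hx => by simp only [F, clampCube_eq_self hx]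
  have hFM : ∀ x, ‖F x‖ ≤ M.toNNReal := fun x =>
    (hM _ (clampCube_mem hR x)).trans (Real.le_coe_toNNReal M)
  obtain ⟨δ, hδ, hball⟩ := Metric.isOpen_iff.1
    (isOpen_lt hL.continuous (continuous_const (y := η))) (γ₀ T) hTη
  -- By Grönwall, starting this close keeps the distance on [0, T] below 1 (no exit from the cube)
  -- and below δ (entry into the sublevel set at time T).
  set r := min 1 δ * Real.exp (-(K * T))
  have hr : 0 < r := by positivity
  refine Filter.mem_of_superset (Metric.ball_mem_nhds x₀ hr) fun x hx => ?_
  obtain ⟨γ, hγ0, hγ⟩ := exists_solution_Ici_of_lipschitzWith hF hFM x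
  have hγcont : ContinuousOn γ (Ici 0) := fun t ht => (hγ t ht).continuousWithinAt
  have hclose : ∀ t ∈ Icc 0 T, dist (γ t) (γ₀ t) < min 1 δ := by
    intro t ht
    have h := dist_le_of_trajectories_ODE (v := fun _ => F) (fun _ => hF)
      (hγcont.mono Icc_subset_Ici_self)
      (fun u hu => (hγ u hu.1).mono (Ici_subset_Ici.2 hu.1)) hcont
      (fun u hu => ?_) (le_of_eq rfl) t ht
    · refine h.trans_lt ?_
      rw [hγ0, h0, sub_zero]
      have h2 : Real.exp (K * t) ≤ Real.exp (K * T) := by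
        gcongr
        exact ht.2
      calc dist x x₀ * Real.exp (K * t) ≤ dist x x₀ * Real.exp (K * T) := by gcongr
        _ < r * Real.exp (K * T) := by
          gcongr
          exact hx
        _ = min 1 δ := by
          rw [mul_assoc, ← Real.exp_add]; simp
    · have : F (γ₀ u) = X (γ₀ u) := hFX _
        ((hR₁ u (Ico_subset_Icc_self hu)).trans (le_trans (by linarith) (le_max_left _ _)))
      simp only [this]
      exact (hsol u hu.1).mono (Ici_subset_Ici.2 hu.1)
  have hTT : T ∈ Icc 0 T := ⟨hT0, le_rfl⟩
  have hLT : L (γ T) < η := hball ((hclose T hTT).trans_le (min_le_right _ _))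
  have hTsub : Ici T ⊆ Ici (0 : ℝ) := Ici_subset_Ici.2 hT0
  have hlate := le_mul_exp_of_deriv_le (ℓ := fun t => L (γ t))
    (ℓ' := fun t => fderiv ℝ L (γ t) (F (γ t))) hc
    (fun t ht => (hL (γ t)).hasFDerivAt.comp_hasDerivWithinAt t ((hγ t (hTsub ht)).mono hTsub))
    (fun t _ ht => by
      rw [hFX _ ((hsub _ ht).trans (le_max_right _ _))]
      exact hdec _ ht)
    (le_trans (by positivity) (hLm _)) hLT
  refine ⟨γ, hγ0, fun t ht => ?_, ?_⟩
  · have hle : ‖γ t‖ ≤ R := by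
      rcases le_total t T with h | h
      · have h1 := (hclose t ⟨ht, h⟩).trans_le (min_le_left _ _)
        have h2 := hR₁ t ⟨ht, h⟩
        have h3 : ‖γ t‖ ≤ ‖γ₀ t‖ + dist (γ t) (γ₀ t) := by
          rw [dist_eq_norm]
          calc ‖γ t‖ = ‖γ₀ t + (γ t - γ₀ t)‖ := by congr 1; abel
            _ ≤ _ := norm_add_le _ _
        exact le_trans (by linarith) (le_max_left _ _)
      · exact (hsub _ (hlate t h).1).trans (le_max_right _ _)
    rw [← hFX _ hle]
    exact hγ t ht
  · have hexp : Tendsto (fun t => η / m * Real.exp (-(c / 2) * (t - T))) atTop (𝓝 0) := by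
      have h1 : Tendsto (fun t : ℝ => -(c / 2) * (t - T)) atTop atBot :=
        (tendsto_atTop_add_const_right _ (-T) tendsto_id).const_mul_atTop_of_neg (by linarith)
      simpa using (Real.tendsto_exp_atBot.comp h1).const_mul (η / m)
    have hsq : Tendsto (fun t => ‖γ t - p‖ ^ 2) atTop (𝓝 0) := by
      refine tendsto_of_tendsto_of_tendsto_of_le_of_le' tendsto_const_nhds hexp
        (Eventually.of_forall fun t => by positivity) ?_
      filter_upwards [eventually_ge_atTop T] with t ht
      rw [div_mul_eq_mul_div, le_div_iff₀ hm]
      linarith [hLm (γ t), (hlate t ht).2]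
    rw [tendsto_iff_norm_sub_tendsto_zero]
    have := (Real.continuous_sqrt.tendsto 0).comp hsq
    simpa [Function.comp_def, Real.sqrt_sq (norm_nonneg _)] using this

/-! ### Submanifolds given as graphs or as open parts of subspaces -/

/-- The coordinate subspace of the coordinates in `s`. -/
def coordSubspace (s : Finset (Fin 6)) : Submodule ℝ Space6 where
  carrier := {y | ∀ i ∉ s, y i = 0}
  add_mem' ha hb i hi := by simp [ha i hi, hb i hi]
  zero_mem' i _ := rfl
  smul_mem' c y hy i hi := by simp [hy i hi]

theorem finrank_coordSubspace (s : Finset (Fin 6)) :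
    Module.finrank ℝ (coordSubspace s) = s.card := by
  let e : coordSubspace s ≃ₗ[ℝ] (s → ℝ) :=
    { toFun := fun y i => y.1 i
      map_add' := fun _ _ => rfl
      map_smul' := fun _ _ => rfl
      invFun := fun v => ⟨fun i => if h : i ∈ s then v ⟨i, h⟩ else 0, fun i hi => by simp [hi]⟩
      left_inv := fun y => by
        ext i
        by_cases h : i ∈ s
        · simp [h]
        · simp [h, y.2 i h]
      right_inv := fun v => by
        ext i
        simp }
  rw [e.finrank_eq, Module.finrank_fintype_fun_eq_card, Fintype.card_coe]

/-- The projection to the coordinates in `s`. -/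
def coordProj (s : Finset (Fin 6)) (y : Space6) : Space6 := fun i => if i ∈ s then y i else 0

theorem contDiff_coordProj (s : Finset (Fin 6)) : ContDiff ℝ ∞ (coordProj s) := by
  rw [contDiff_pi]
  intro i
  by_cases h : i ∈ s
  · simpa [coordProj, h] using contDiff_apply ℝ ℝ i
  · simpa [coordProj, h] using contDiff_const

/-- The points of `O` fixed by `f`, where `f` only depends on the coordinates in `s` and preserves
them: the graph of a map from these coordinates to the others. -/
theorem isSmoothSubmanifold_graph {s : Finset (Fin 6)} {O : Set Space6} (hO : IsOpen O)
    {f : Space6 → Space6} (hf : ContDiffOn ℝ ∞ f O)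
    (hfs : ∀ y z : Space6, (∀ i ∈ s, y i = z i) → f y = f z)
    (hOs : ∀ y z : Space6, (∀ i ∈ s, y i = z i) → y ∈ O → z ∈ O)
    (hid : ∀ y ∈ O, ∀ i ∈ s, f y i = y i) (hne : ∃ y ∈ O, f y = y) :
    IsSmoothSubmanifold s.card {y | y ∈ O ∧ f y = y} := by
  refine ⟨hne, fun x hx => ?_⟩
  have h1 : ∀ y ∈ O, ∀ i ∈ s, (y - f y + coordProj s y) i = y i := fun y hy i hi => by
    simp [coordProj, hi, hid y hy i hi]
  have h2 : ∀ y ∈ O, ∀ i ∈ s, (y + f y - coordProj s y) i = y i := fun y hy i hi => by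
    simp [coordProj, hi, hid y hy i hi]
  have hproj : ∀ y z : Space6, (∀ i ∈ s, y i = z i) → coordProj s y = coordProj s z := by
    intro y z h
    funext i
    by_cases hi : i ∈ s <;> simp [coordProj, hi, h]
  -- A shear that slides the graph onto the coordinate subspace. It moves only the coordinates
  -- outside s, on which neither f nor O depends, so the inverse is explicit and O is mapped onto
  -- itself.
  let Φ : OpenPartialHomeomorph Space6 Space6 :=
    { toFun := fun y => y - f y + coordProj s y
      invFun := fun y => y + f y - coordProj s y
      source := O
      target := O
      map_source' := fun y hy => hOs y _ (fun i hi => (h1 y hy i hi).symm) hy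
      map_target' := fun y hy => hOs y _ (fun i hi => (h2 y hy i hi).symm) hy
      left_inv' := fun y hy => by
        rw [hfs _ y (h1 y hy), hproj _ y (h1 y hy)]
        abel
      right_inv' := fun y hy => by
        rw [hfs _ y (h2 y hy), hproj _ y (h2 y hy)]
        abel
      open_source := hO
      open_target := hO
      continuousOn_toFun := (continuousOn_id.sub hf.continuousOn).add
        (contDiff_coordProj s).continuous.continuousOn
      continuousOn_invFun := (continuousOn_id.add hf.continuousOn).sub
        (contDiff_coordProj s).continuous.continuousOn }
  refine ⟨Φ, coordSubspace s, finrank_coordSubspace s, hx.1,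
    (contDiffOn_id.sub hf).add (contDiff_coordProj s).contDiffOn,
    (contDiffOn_id.add hf).sub (contDiff_coordProj s).contDiffOn, ?_⟩
  ext z
  constructor
  · rintro ⟨y, ⟨⟨hyO, hy⟩, -⟩, rfl⟩
    refine ⟨fun i hi => ?_, Φ.map_source hyO⟩
    change (y - f y + coordProj s y) i = 0
    simp [hy, coordProj, hi]
  · rintro ⟨hz, hzO : z ∈ O⟩
    have hzp : coordProj s z = z := by
      funext i
      by_cases hi : i ∈ s
      · simp [coordProj, hi]
      · simp [coordProj, hi, hz i hi]
    have hfz : f (f z) = f z := hfs _ _ (hid z hzO)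
    have hfO : f z ∈ O := hOs z _ (fun i hi => (hid z hzO i hi).symm) hzO
    refine ⟨f z, ⟨⟨hfO, hfz⟩, hfO⟩, ?_⟩
    change f z - f (f z) + coordProj s (f z) = z
    rw [hfz, hproj _ z (hid z hzO), hzp]
    abel

/-- Differentiating f(c(t)) = c(t) gives one inclusion. For the other, f(x + tw) runs in the graph
and has velocity f'w = w. -/
theorem tangentVectors_graph {s : Finset (Fin 6)} {O : Set Space6} (hO : IsOpen O)
    {f : Space6 → Space6}
    (hfs : ∀ y z : Space6, (∀ i ∈ s, y i = z i) → f y = f z)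
    (hOs : ∀ y z : Space6, (∀ i ∈ s, y i = z i) → y ∈ O → z ∈ O)
    (hid : ∀ y ∈ O, ∀ i ∈ s, f y i = y i) {x : Space6} (hx : x ∈ O) (hfx : f x = x)
    {f' : Space6 →L[ℝ] Space6} (hf : HasFDerivAt f f' x) :
    tangentVectors {y | y ∈ O ∧ f y = y} x = {w | f' w = w} := by
  ext w
  constructor
  · rintro ⟨c, h0, hc, hmem⟩
    have h1 : HasDerivAt (fun t => f (c t)) (f' w) 0 := by
      rw [← h0] at hf
      exact hf.comp_hasDerivAt 0 hc
    exact h1.unique (hc.congr_of_eventuallyEq (hmem.mono fun t ht => ht.2))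
  · intro hw
    have h1 : HasDerivAt (fun t : ℝ => x + t • w) w 0 := by
      simpa using ((hasDerivAt_id (0 : ℝ)).smul_const w).const_add x
    have h0 : x + (0 : ℝ) • w = x := by simp
    have h2 : HasDerivAt (fun t : ℝ => f (x + t • w)) (f' w) 0 := by
      rw [← h0] at hf
      exact hf.comp_hasDerivAt 0 h1
    refine ⟨fun t => f (x + t • w), by simp [hfx], by rwa [show f' w = w from hw] at h2, ?_⟩
    have h3 : ∀ᶠ t : ℝ in 𝓝 0, x + t • w ∈ O :=
      h1.continuousAt.eventually (hO.mem_nhds (by simpa using hx))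
    filter_upwards [h3] with t ht
    exact ⟨hOs _ _ (fun i hi => (hid _ ht i hi).symm) ht, hfs _ _ (hid _ ht)⟩

theorem isSmoothSubmanifold_coordSubspace_inter {s : Finset (Fin 6)} {O : Set Space6}
    (hO : IsOpen O) (hne : ((coordSubspace s : Set Space6) ∩ O).Nonempty) :
    IsSmoothSubmanifold s.card ((coordSubspace s : Set Space6) ∩ O) := by
  refine ⟨hne, fun x hx => ⟨OpenPartialHomeomorph.ofSet O hO, coordSubspace s,
    finrank_coordSubspace s, hx.2, contDiffOn_id, contDiffOn_id, ?_⟩⟩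
  simp [inter_assoc]

theorem IsSmoothSubmanifold.preimage {k : ℕ} {S : Set Space6} (hS : IsSmoothSubmanifold k S)
    (R : Space6 ≃L[ℝ] Space6) : IsSmoothSubmanifold k (R ⁻¹' S) := by
  obtain ⟨⟨y, hy⟩, hS⟩ := hS
  refine ⟨⟨R.symm y, by simpa using hy⟩, fun x hx => ?_⟩
  obtain ⟨Φ, W, hW, hxs, hΦ, hΦs, him⟩ := hS (R x) hx
  refine ⟨R.toHomeomorph.toOpenPartialHomeomorph.trans Φ, W, hW, by simpa using hxs, ?_, ?_, ?_⟩
  · refine hΦ.comp R.contDiff.contDiffOn fun z hz => ?_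
    simpa using hz
  · refine R.symm.contDiff.comp_contDiffOn (hΦs.mono fun z hz => ?_)
    simpa using hz
  · ext z
    have h := Set.ext_iff.1 him z
    simp only [mem_image, mem_inter_iff] at h
    simp only [OpenPartialHomeomorph.coe_trans, mem_image, mem_inter_iff, mem_preimage,
      OpenPartialHomeomorph.trans_source, OpenPartialHomeomorph.trans_target]
    constructor
    · rintro ⟨u, ⟨hu, hu'⟩, rfl⟩
      have := (h.1 ⟨R u, ⟨hu, by simpa using hu'⟩, rfl⟩)
      simpa using this
    · rintro ⟨h1, h2⟩
      obtain ⟨v, ⟨hv, hv'⟩, rfl⟩ := h.2 ⟨h1, by simpa using h2⟩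
      exact ⟨R.symm v, by simpa using ⟨hv, hv'⟩, by simp⟩

theorem tangentVectors_preimage (S : Set Space6) (R : Space6 ≃L[ℝ] Space6) (x : Space6) :
    tangentVectors (R ⁻¹' S) x = R ⁻¹' tangentVectors S (R x) := by
  ext w
  constructor
  · rintro ⟨c, h0, hc, hmem⟩
    exact ⟨fun t => R (c t), by simp [h0], R.hasFDerivAt.comp_hasDerivAt 0 hc, hmem⟩
  · rintro ⟨c, h0, hc, hmem⟩
    exact ⟨fun t => R.symm (c t), by simp [h0],
      (R.symm.hasFDerivAt.comp_hasDerivAt 0 hc).congr_deriv (by simp), by simpa using hmem⟩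

/-! ### Reversing symmetries -/

/-- The sign produced by reversing time cancels the one in X ∘ R = -R ∘ X. All statements about
unstable sets are reduced to stable ones through this. -/
theorem IsSolutionOn.reverse {X : Space6 → Space6} {R : Space6 ≃L[ℝ] Space6}
    (hX : ∀ x, X (R x) = -R (X x)) {γ : ℝ → Space6} {J : Set ℝ} (hγ : IsSolutionOn X γ J) :
    IsSolutionOn X (fun t => R (γ (-t))) (Neg.neg ⁻¹' J) := by
  intro t ht
  have h := (hγ (-t) ht).scomp t (hasDerivWithinAt_neg t (Neg.neg ⁻¹' J)) (fun u hu => hu)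
  refine (R.hasFDerivAt.comp_hasDerivWithinAt t h).congr_deriv ?_
  simp [hX]

theorem neg_preimage_Ici_zero : (Neg.neg ⁻¹' Ici (0 : ℝ) : Set ℝ) = Iic 0 := by
  ext; simp

theorem neg_preimage_Iic_zero : (Neg.neg ⁻¹' Iic (0 : ℝ) : Set ℝ) = Ici 0 := by
  ext; simp

theorem unstableManifold_eq_preimage {X : Space6 → Space6} {R : Space6 ≃L[ℝ] Space6}
    (hX : ∀ x, X (R x) = -R (X x)) (hR : ∀ x, R (R x) = x) (p : Space6) :
    unstableManifold X p = R ⁻¹' stableManifold X (R p) := by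
  ext x
  constructor
  · rintro ⟨γ, h0, hγ, hlim⟩
    have h := hγ.reverse hX
    rw [neg_preimage_Iic_zero] at h
    exact ⟨_, by simp [h0], h, (R.continuous.tendsto p).comp (hlim.comp tendsto_neg_atTop_atBot)⟩
  · rintro ⟨γ, h0, hγ, hlim⟩
    have h := hγ.reverse hX
    rw [neg_preimage_Ici_zero] at h
    refine ⟨_, by simp [h0, hR], h, ?_⟩
    have := (R.continuous.tendsto _).comp (hlim.comp tendsto_neg_atBot_atTop)
    rwa [hR] at this

theorem localUnstableFiber_eq_preimage {X : Space6 → Space6} {R : Space6 ≃L[ℝ] Space6}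
    (hX : ∀ x, X (R x) = -R (X x)) (hR : ∀ x, R (R x) = x) (hn : ∀ x, ‖R x‖ = ‖x‖)
    (p : Space6) (U : Set Space6) :
    localUnstableFiber X p U = R ⁻¹' localStableFiber X (R p) (R ⁻¹' U) := by
  ext x
  constructor
  · rintro ⟨γ, h0, hγ, hU, C, hC, μ, hμ, hb⟩
    have h := hγ.reverse hX
    rw [neg_preimage_Iic_zero] at h
    refine ⟨_, by simp [h0], h, fun t ht => ?_, C, hC, μ, hμ, fun t ht => ?_⟩
    · simpa [hR] using hU (-t) (by simpa using ht)
    · rw [← map_sub, hn]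
      simpa using hb (-t) (by simpa using ht)
  · rintro ⟨γ, h0, hγ, hU, C, hC, μ, hμ, hb⟩
    have h := hγ.reverse hX
    rw [neg_preimage_Ici_zero] at h
    refine ⟨_, by simp [h0, hR], h, fun t ht => hU (-t) (by simpa using ht), C, hC, μ, hμ,
      fun t ht => ?_⟩
    have h2 := hb (-t) (by simpa using ht)
    rw [← hn, map_sub, hR] at h2
    simpa using h2

/-! ### The chart field in coordinates -/

theorem chartField_0 (A : ℝ) (x : Space6) : chartField A x 0 = -(1 / 2) * x 0 * x 1 := rfl
theorem chartField_1 (A : ℝ) (x : Space6) : chartField A x 1 = 3 / 2 * x 1 ^ 2 + chartG A x := rfl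
theorem chartField_2 (A : ℝ) (x : Space6) : chartField A x 2 = 2 * x 1 * x 2 + x 4 * x 3 := rfl
theorem chartField_3 (A : ℝ) (x : Space6) :
    chartField A x 3 = 3 / 2 * x 1 * x 3 - x 4 - x 0 ^ 2 * x 4 * chartG A x := rfl
theorem chartField_4 (A : ℝ) (x : Space6) : chartField A x 4 = x 4 * x 1 := rfl
theorem chartField_5 (A : ℝ) (x : Space6) : chartField A x 5 = 2 * x 5 * x 1 := rfl

/-- In terms of u = A - r₁² the expression is linear in V₁ and ℬ₁ with powers of u as coefficients,
so its zero set is solved for V₁ at once. -/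
theorem chartG_eq (A : ℝ) (x : Space6) :
    chartG A x = x 5 * (A - x 0 ^ 2) - x 2 * (A - x 0 ^ 2) ^ 2 - 1 / A := by
  simp only [chartG, chartF]
  ring

theorem rho_pos {A : ℝ} (hA : 0 < A) : 0 < rho A := Real.sqrt_pos.2 (by positivity)

theorem rho_sq {A : ℝ} (hA : 0 < A) : rho A ^ 2 = 2 / (3 * A) := Real.sq_sqrt (by positivity)

/-- Turns the P₁-equation on the line I into P₁' = (3/2)(P₁² - ρ²). -/
theorem inv_eq_rho_sq {A : ℝ} (hA : 0 < A) : 1 / A = 3 / 2 * rho A ^ 2 := by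
  rw [rho_sq hA]
  field_simp

theorem IsSolutionOn.coord {X : Space6 → Space6} {γ : ℝ → Space6} {J : Set ℝ}
    (h : IsSolutionOn X γ J) (i : Fin 6) {t : ℝ} (ht : t ∈ J) :
    HasDerivWithinAt (fun t => γ t i) (X (γ t) i) J t :=
  hasDerivWithinAt_pi.1 (h t ht) i

theorem IsSolutionOn.continuousOn_coord {X : Space6 → Space6} {γ : ℝ → Space6} {J : Set ℝ}
    (h : IsSolutionOn X γ J) (i : Fin 6) : ContinuousOn (fun t => γ t i) J :=
  fun _ ht => (h.coord i ht).continuousWithinAt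

/-- The reflection as a continuous linear equivalence. -/
noncomputable def reflectionEquiv : Space6 ≃L[ℝ] Space6 :=
  (LinearEquiv.ofInvolutive
    { toFun := reflection
      map_add' := fun x y => by
        ext i
        fin_cases i <;> simp [reflection, add_comm]
      map_smul' := fun c x => by
        ext i
        fin_cases i <;> simp [reflection] }
    (fun x => by
      ext i
      fin_cases i <;> simp [reflection])).toContinuousLinearEquiv

theorem coe_reflectionEquiv (x : Space6) : reflectionEquiv x = reflection x := rfl

theorem reflection_reflection (x : Space6) : reflection (reflection x) = x := by
  ext i
  fin_cases i <;> simp [reflection]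

theorem norm_reflection (x : Space6) : ‖reflection x‖ = ‖x‖ := by
  have h : ∀ y : Space6, ‖reflection y‖ ≤ ‖y‖ := fun y => by
    rw [pi_norm_le_iff_of_nonneg (norm_nonneg _)]
    intro i
    have := norm_le_pi_norm y i
    fin_cases i <;> simpa [reflection] using this
  refine le_antisymm (h x) ?_
  simpa only [reflection_reflection] using h (reflection x)

theorem chartField_reflection (A : ℝ) (x : Space6) :
    chartField A (reflection x) = -reflection (chartField A x) := by
  ext i
  fin_cases i <;> simp [reflection, chartField, chartG, chartF]
  all_goals ring

theorem reflection_Eplus (A : ℝ) : reflection (Eplus A) = Eminus A := by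
  ext i
  fin_cases i <;> simp [reflection, Eplus, Eminus]

theorem reflection_Eminus (A : ℝ) : reflection (Eminus A) = Eplus A := by
  rw [← reflection_Eplus, reflection_reflection]

theorem isInvariantSet_lineI (A : ℝ) : IsInvariantSet (chartField A) lineI := by
  rintro γ J hJ hγ s hs ⟨h0, h2, h3, h4, h5⟩
  have hP := hγ.continuousOn_coord 1
  have z0 : ∀ t ∈ J, γ t 0 = 0 := eq_zero_of_hasDerivWithinAt_mul
    (a := fun t => -(1 / 2) * γ t 1) hJ (continuousOn_const.mul hP)
    (fun u hu => (hγ.coord 0 hu).congr_deriv (by simp only [chartField_0]; ring)) hs h0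
  have z4 : ∀ t ∈ J, γ t 4 = 0 := eq_zero_of_hasDerivWithinAt_mul hJ hP
    (fun u hu => (hγ.coord 4 hu).congr_deriv (by rw [chartField_4]; ring)) hs h4
  have z5 : ∀ t ∈ J, γ t 5 = 0 := eq_zero_of_hasDerivWithinAt_mul
    (a := fun t => 2 * γ t 1) hJ (continuousOn_const.mul hP)
    (fun u hu => (hγ.coord 5 hu).congr_deriv (by simp only [chartField_5]; ring)) hs h5
  -- The equations for V₁ and Q₁ become homogeneous only now that ε₁ = 0 is known.
  have z2 : ∀ t ∈ J, γ t 2 = 0 := eq_zero_of_hasDerivWithinAt_mul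
    (a := fun t => 2 * γ t 1) hJ (continuousOn_const.mul hP)
    (fun u hu => (hγ.coord 2 hu).congr_deriv
      (by simp only [chartField_2, z4 u hu]; ring)) hs h2
  have z3 : ∀ t ∈ J, γ t 3 = 0 := eq_zero_of_hasDerivWithinAt_mul
    (a := fun t => 3 / 2 * γ t 1) hJ (continuousOn_const.mul hP)
    (fun u hu => (hγ.coord 3 hu).congr_deriv
      (by simp only [chartField_3, z4 u hu]; ring)) hs h3
  exact fun t ht => ⟨z0 t ht, z2 t ht, z3 t ht, z4 t ht, z5 t ht⟩

/-- Dividing by P₁ kills r₁, ε₁, ℬ₁ and then V₁, Q₁; what is left is (3/2)(P₁² - ρ²) = 0. -/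
theorem chartField_eq_zero_iff {A : ℝ} (hA : 0 < A) {x : Space6} (hx : x 1 ≠ 0) :
    chartField A x = 0 ↔ x ∈ lineI ∧ x 1 ^ 2 = rho A ^ 2 := by
  have hr := inv_eq_rho_sq hA
  constructor
  · intro h
    have e : ∀ i, chartField A x i = 0 := fun i => by rw [h]; rfl
    have h0 : x 0 = 0 := by simpa [chartField_0, hx] using e 0
    have h4 : x 4 = 0 := by simpa [chartField_4, hx] using e 4
    have h5 : x 5 = 0 := by simpa [chartField_5, hx] using e 5
    have h2 : x 2 = 0 := by simpa [chartField_2, hx, h4] using e 2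
    have h3 : x 3 = 0 := by simpa [chartField_3, hx, h4] using e 3
    have h1 := e 1
    rw [chartField_1, chartG_eq, h5, h2, hr] at h1
    exact ⟨⟨h0, h2, h3, h4, h5⟩, by linarith⟩
  · rintro ⟨⟨h0, h2, h3, h4, h5⟩, h1⟩
    ext i
    fin_cases i <;> simp [chartField, chartG_eq, h0, h2, h3, h4, h5]
    rw [← one_div, hr, h1]
    ring

theorem isIsolatedEquilibrium_chartField {A : ℝ} (hA : 0 < A) {p : Space6} (hp : p ∈ lineI)
    (hp1 : p 1 ^ 2 = rho A ^ 2) : IsIsolatedEquilibrium (chartField A) p := by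
  have hne : p 1 ≠ 0 := by
    intro h
    rw [h] at hp1
    have := rho_pos hA
    nlinarith
  refine ⟨(chartField_eq_zero_iff hA hne).2 ⟨hp, hp1⟩, ?_⟩
  -- Near p the coordinate P₁ is nonzero and has the sign of that of p, which excludes both the
  -- equilibria with P₁ = 0 and the mirror point.
  have hopen : ∀ᶠ x : Space6 in 𝓝 p, 0 < x 1 * p 1 :=
    ((continuous_apply (1 : Fin 6)).mul continuous_const).continuousAt.eventually_const_lt
      (mul_self_pos.2 hne)
  rw [eventually_nhdsWithin_iff]
  filter_upwards [hopen] with x hx hxp h0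
  have hx1 : x 1 ≠ 0 := fun h => by simp [h] at hx
  obtain ⟨hI, h1⟩ := (chartField_eq_zero_iff hA hx1).1 h0
  have h2 : x 1 = p 1 := by
    rcases sq_eq_sq_iff_eq_or_eq_neg.1 (h1.trans hp1.symm) with h | h
    · exact h
    · rw [h] at hx
      nlinarith [mul_self_nonneg (p 1)]
  refine hxp ?_
  obtain ⟨a0, a2, a3, a4, a5⟩ := hI
  obtain ⟨b0, b2, b3, b4, b5⟩ := hp
  ext i
  fin_cases i
  exacts [a0.trans b0.symm, h2, a2.trans b2.symm, a3.trans b3.symm, a4.trans b4.symm,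
    a5.trans b5.symm]

theorem Eplus_mem_lineI (A : ℝ) : Eplus A ∈ lineI := by simp [lineI, Eplus]

theorem Eminus_mem_lineI (A : ℝ) : Eminus A ∈ lineI := by simp [lineI, Eminus]

/-! ### The one-dimensional stable manifold of `E₊` -/

/-- Along a solution converging to E₊ all coordinates but r₁ have an eventually positive growth rate
and hence equal their limits. On the resulting line the solutions are explicit, with r₁ decaying
like e^(-ρt/2). -/
theorem stableManifold_Eplus {A : ℝ} (hA : 0 < A) :
    stableManifold (chartField A) (Eplus A) =
      {x | x ∈ univ ∧ (![x 0, rho A, 0, 0, 0, 0] : Space6) = x} := by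
  have hρ := rho_pos hA
  have hr := inv_eq_rho_sq hA
  ext x
  constructor
  · rintro ⟨γ, h0, hγ, hlim⟩
    have hl : ∀ i, Tendsto (fun t => γ t i) atTop (𝓝 (Eplus A i)) := tendsto_pi_nhds.1 hlim
    have hP := hγ.continuousOn_coord 1
    have hl1 : Tendsto (fun t => γ t 1) atTop (𝓝 (rho A)) := hl 1
    have hpos : ∀ᶠ t in atTop, 0 < γ t 1 := hl1.eventually_const_lt hρ
    have z4 : ∀ t ∈ Ici (0 : ℝ), γ t 4 = 0 := eq_zero_of_tendsto_of_eventually_nonneg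
      (fun u hu => (hγ.coord 4 hu).congr_deriv (by rw [chartField_4]; ring)) hP
      (hpos.mono fun t ht => ht.le) (hl 4)
    have z5 : ∀ t ∈ Ici (0 : ℝ), γ t 5 = 0 := eq_zero_of_tendsto_of_eventually_nonneg
      (c := fun t => 2 * γ t 1)
      (fun u hu => (hγ.coord 5 hu).congr_deriv (by
        simp only [chartField_5]; ring)) (continuousOn_const.mul hP)
      (hpos.mono fun t ht => by positivity) (hl 5)
    have z2 : ∀ t ∈ Ici (0 : ℝ), γ t 2 = 0 := eq_zero_of_tendsto_of_eventually_nonneg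
      (c := fun t => 2 * γ t 1)
      (fun u hu => (hγ.coord 2 hu).congr_deriv (by
        simp only [chartField_2, z4 u hu]; ring)) (continuousOn_const.mul hP)
      (hpos.mono fun t ht => by positivity) (hl 2)
    have z3 : ∀ t ∈ Ici (0 : ℝ), γ t 3 = 0 := eq_zero_of_tendsto_of_eventually_nonneg
      (c := fun t => 3 / 2 * γ t 1)
      (fun u hu => (hγ.coord 3 hu).congr_deriv (by
        simp only [chartField_3, z4 u hu]; ring)) (continuousOn_const.mul hP)
      (hpos.mono fun t ht => by positivity) (hl 3)
    -- With V₁ = ℬ₁ = 0 the equation factors as (P₁ - ρ)' = (3/2)(P₁ + ρ)(P₁ - ρ).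
    have z1 : ∀ t ∈ Ici (0 : ℝ), γ t 1 - rho A = 0 := eq_zero_of_tendsto_of_eventually_nonneg
      (c := fun t => (3 / 2 : ℝ) • (γ t 1 + rho A))
      (fun u hu => ((hγ.coord 1 hu).sub_const (rho A)).congr_deriv (by
        rw [chartField_1, chartG_eq, z5 u hu, z2 u hu, hr, smul_eq_mul]; ring))
      ((hP.add continuousOn_const).const_smul (3 / 2 : ℝ))
      (hpos.mono fun t ht => by simp only [smul_eq_mul]; positivity)
      (by simpa using hl1.sub_const (rho A))
    have h00 : (0 : ℝ) ∈ Ici (0 : ℝ) := self_mem_Ici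
    refine ⟨mem_univ _, ?_⟩
    rw [← h0]
    ext i
    fin_cases i
    exacts [rfl, (sub_eq_zero.1 (z1 0 h00)).symm, (z2 0 h00).symm, (z3 0 h00).symm,
      (z4 0 h00).symm, (z5 0 h00).symm]
  · rintro ⟨-, hx⟩
    have hE : ∀ t, HasDerivAt (fun t : ℝ => Real.exp (-(rho A / 2) * t))
        (Real.exp (-(rho A / 2) * t) * -(rho A / 2)) t := fun t => by
      simpa using ((hasDerivAt_id t).const_mul (-(rho A / 2))).exp
    refine ⟨fun t => ![x 0 * Real.exp (-(rho A / 2) * t), rho A, 0, 0, 0, 0], ?_, fun t _ => ?_, ?_⟩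
    · simpa using hx
    · rw [hasDerivWithinAt_pi]
      intro i
      fin_cases i
      · refine ((hE t).const_mul (x 0)).hasDerivWithinAt.congr_deriv ?_
        simp [chartField]
        ring
      · refine (hasDerivWithinAt_const t (Ici (0 : ℝ)) (rho A)).congr_deriv ?_
        simp [chartField, chartG_eq]
        rw [← one_div, hr]
        ring
      all_goals
        refine (hasDerivWithinAt_const t (Ici (0 : ℝ)) (0 : ℝ)).congr_deriv ?_
        simp [chartField]
    · have h1 : Tendsto (fun t : ℝ => x 0 * Real.exp (-(rho A / 2) * t)) atTop (𝓝 0) := by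
        simpa using (Real.tendsto_exp_atBot.comp (tendsto_id.const_mul_atTop_of_neg
          (show -(rho A / 2) < 0 by linarith))).const_mul (x 0)
      rw [tendsto_pi_nhds]
      intro i
      fin_cases i
      exacts [h1, tendsto_const_nhds, tendsto_const_nhds, tendsto_const_nhds, tendsto_const_nhds,
        tendsto_const_nhds]

theorem isSmoothSubmanifold_stableManifold_Eplus {A : ℝ} (hA : 0 < A) :
    IsSmoothSubmanifold 1 (stableManifold (chartField A) (Eplus A)) := by
  rw [stableManifold_Eplus hA]
  refine isSmoothSubmanifold_graph (s := {0}) isOpen_univ ?_ (fun y z h => ?_)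
    (fun _ _ _ _ => mem_univ _) (fun y _ i hi => ?_) ⟨Eplus A, mem_univ _, by simp [Eplus]⟩
  · refine ContDiff.contDiffOn (contDiff_pi.2 fun i => ?_)
    fin_cases i
    · exact contDiff_apply ℝ ℝ (0 : Fin 6)
    all_goals exact contDiff_const
  · rw [h 0 (by simp)]
  · rw [Finset.mem_singleton.1 hi]
    rfl

/-! ### The five-dimensional stable manifold of `E₋` -/

/-- The chart field at `r₁ = 0`, extended so that the `r₁`-direction is attracted to `E₋`. -/
noncomputable def attractedField (A : ℝ) (x : Space6) : Space6 :=
  ![x 0 * x 1,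
    3 / 2 * x 1 ^ 2 + (A * x 5 - A ^ 2 * x 2 - 1 / A),
    2 * x 1 * x 2 + x 4 * x 3,
    3 / 2 * x 1 * x 3 - x 4,
    x 4 * x 1,
    2 * x 5 * x 1]

theorem attractedField_eq_chartField {A : ℝ} {x : Space6} (hx : x 0 = 0) :
    attractedField A x = chartField A x := by
  ext i
  fin_cases i <;> simp [attractedField, chartField, chartG, hx]

theorem contDiff_attractedField (A : ℝ) : ContDiff ℝ 1 (attractedField A) := by
  have h : ∀ i : Fin 6, ContDiff ℝ 1 (fun x : Space6 => x i) := fun i => contDiff_apply ℝ ℝ i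
  refine contDiff_pi.2 fun i => ?_
  fin_cases i
  · exact (h 0).mul (h 1)
  · exact (contDiff_const.mul ((h 1).pow 2)).add
      (((contDiff_const.mul (h 5)).sub (contDiff_const.mul (h 2))).sub contDiff_const)
  · exact ((contDiff_const.mul (h 1)).mul (h 2)).add ((h 4).mul (h 3))
  · exact ((contDiff_const.mul (h 1)).mul (h 3)).sub (h 4)
  · exact (h 4).mul (h 1)
  · exact (contDiff_const.mul (h 5)).mul (h 1)

/-- A quadratic Lyapunov function at `E₋`. -/
def lyapunov (k ρ : ℝ) (x : Space6) : ℝ :=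
  x 0 ^ 2 + (x 1 + ρ) ^ 2 + k * (x 2 ^ 2 + x 5 ^ 2) + x 3 ^ 2 + k * x 4 ^ 2

theorem hasFDerivAt_lyapunov (k ρ : ℝ) (x : Space6) : ∃ L' : Space6 →L[ℝ] ℝ,
    HasFDerivAt (lyapunov k ρ) L' x ∧ ∀ v, L' v = 2 * x 0 * v 0 + 2 * (x 1 + ρ) * v 1 +
      k * (2 * x 2 * v 2 + 2 * x 5 * v 5) + 2 * x 3 * v 3 + k * (2 * x 4 * v 4) := by
  have h : ∀ i : Fin 6, HasFDerivAt (fun y : Space6 => y i)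
      (ContinuousLinearMap.proj (R := ℝ) (φ := fun _ : Fin 6 => ℝ) i) x :=
    fun i => hasFDerivAt_apply i x
  refine ⟨_, (((((h 0).pow 2).add (((h 1).add_const ρ).pow 2)).add
    ((((h 2).pow 2).add ((h 5).pow 2)).const_mul k)).add ((h 3).pow 2)).add
    (((h 4).pow 2).const_mul k), fun v => ?_⟩
  simp
  ring

/-- Here p = P₁ + ρ. The couplings of P₁ to ℬ₁ and V₁, and of Q₁ to ε₁, are linear and not small;
the weight k on V₁, ℬ₁, ε₁ is taken large enough to absorb them. The terms A², A⁴ and 2 in the lower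
bound for kρ² serve these three couplings. -/
theorem lyapunov_decrease {A ρ k r p V Q e B : ℝ} (hρ : 0 < ρ) (hk : 1 ≤ k)
    (hk2 : A ^ 2 + A ^ 4 + 2 ≤ k * ρ ^ 2) (hp : |p| ≤ ρ / 8) (hV : k * |V| ≤ ρ / 8) :
    2 * r * (r * (p - ρ)) + 2 * p * (3 / 2 * (p - ρ) ^ 2 + (A * B - A ^ 2 * V - 3 / 2 * ρ ^ 2)) +
      k * (2 * V * (2 * (p - ρ) * V + e * Q) + 2 * B * (2 * B * (p - ρ))) +
      2 * Q * (3 / 2 * (p - ρ) * Q - e) + k * (2 * e * (e * (p - ρ))) ≤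
    -ρ * (r ^ 2 + p ^ 2 + k * (V ^ 2 + B ^ 2) + Q ^ 2 + k * e ^ 2) := by
  have hp1 := (abs_le.1 hp).2
  have hAk : A ^ 2 / ρ ≤ k * ρ := by
    rw [div_le_iff₀ hρ]; nlinarith [sq_nonneg (A ^ 2)]
  have hAk4 : A ^ 4 / ρ ≤ k * ρ := by
    rw [div_le_iff₀ hρ]; nlinarith [sq_nonneg A]
  have hk1 : 1 / ρ ≤ k * ρ / 2 := by
    rw [div_le_iff₀ hρ]; nlinarith [sq_nonneg A, sq_nonneg (A ^ 2)]
  -- Young's inequality, from a completed square divided by ρ; the next two bounds are of the same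
  -- kind.
  have c1 : 2 * p * (A * B) ≤ ρ * p ^ 2 + k * ρ * B ^ 2 := by
    have : 0 ≤ (ρ * p - A * B) ^ 2 / ρ := by positivity
    have e1 : (ρ * p - A * B) ^ 2 / ρ = ρ * p ^ 2 - 2 * p * (A * B) + A ^ 2 / ρ * B ^ 2 := by
      field_simp; ring
    nlinarith [mul_le_mul_of_nonneg_right hAk (sq_nonneg B)]
  have c2 : -(2 * p * (A ^ 2 * V)) ≤ ρ * p ^ 2 + k * ρ * V ^ 2 := by
    have : 0 ≤ (ρ * p + A ^ 2 * V) ^ 2 / ρ := by positivity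
    have e1 : (ρ * p + A ^ 2 * V) ^ 2 / ρ =
        ρ * p ^ 2 + 2 * p * (A ^ 2 * V) + A ^ 4 / ρ * V ^ 2 := by
      field_simp; ring
    nlinarith [mul_le_mul_of_nonneg_right hAk4 (sq_nonneg V)]
  have c3 : -(2 * Q * e) ≤ ρ * Q ^ 2 + k * ρ / 2 * e ^ 2 := by
    have : 0 ≤ (ρ * Q + e) ^ 2 / ρ := by positivity
    have e1 : (ρ * Q + e) ^ 2 / ρ = ρ * Q ^ 2 + 2 * Q * e + 1 / ρ * e ^ 2 := by
      field_simp
      ring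
    nlinarith [mul_le_mul_of_nonneg_right hk1 (sq_nonneg e)]
  -- The cubic term is harmless only because k|V| is small.
  have c4 : k * (2 * V * (e * Q)) ≤ ρ / 8 * Q ^ 2 + k * (ρ / 8 * e ^ 2) := by
    have h1 : 2 * V * (e * Q) ≤ |V| * (e ^ 2 + Q ^ 2) := by
      rcases abs_cases V with ⟨h, h'⟩ | ⟨h, h'⟩ <;> rw [h]
      · nlinarith [mul_nonneg h' (sq_nonneg (e - Q))]
      · nlinarith [mul_nonneg (neg_nonneg.2 h'.le) (sq_nonneg (e + Q))]
    have h2 : |V| * k * (e ^ 2 + Q ^ 2) ≤ ρ / 8 * (e ^ 2 + Q ^ 2) :=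
      mul_le_mul_of_nonneg_right (by linarith) (by positivity)
    have h3 : ρ / 8 * e ^ 2 ≤ k * (ρ / 8 * e ^ 2) := le_mul_of_one_le_left (by positivity) hk
    nlinarith [mul_le_mul_of_nonneg_left h1 (by linarith : (0 : ℝ) ≤ k)]
  have q : ∀ a : ℝ, (p - ρ) * a ^ 2 ≤ -(7 / 8 * ρ) * a ^ 2 := fun a =>
    mul_le_mul_of_nonneg_right (by linarith) (sq_nonneg a)
  have qk : ∀ a : ℝ, k * ((p - ρ) * a ^ 2) ≤ k * (-(7 / 8 * ρ) * a ^ 2) := fun a =>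
    mul_le_mul_of_nonneg_left (q a) (by linarith)
  have d1 : p ^ 2 * p ≤ p ^ 2 * (ρ / 8) := mul_le_mul_of_nonneg_left hp1 (sq_nonneg p)
  have n1 : 0 ≤ ρ * r ^ 2 := by positivity
  have n2 : 0 ≤ ρ * p ^ 2 := by positivity
  have n3 : 0 ≤ k * ρ * V ^ 2 := by positivity
  have n4 : 0 ≤ k * ρ * B ^ 2 := by positivity
  have n5 : 0 ≤ ρ * Q ^ 2 := by positivity
  have n6 : 0 ≤ k * ρ * e ^ 2 := by positivity
  linarith [q r, q Q, qk V, qk B, qk e]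

theorem isOpen_stableManifold_attractedField {A : ℝ} (hA : 0 < A) :
    IsOpen (stableManifold (attractedField A) (Eminus A)) := by
  have hρ := rho_pos hA
  have hr := inv_eq_rho_sq hA
  set ρ := rho A with hρdef
  set k := 1 + (A ^ 2 + A ^ 4 + 2) / ρ ^ 2 with hk
  have hk1 : 1 ≤ k := by
    rw [hk]
    have : 0 ≤ (A ^ 2 + A ^ 4 + 2) / ρ ^ 2 := by positivity
    linarith
  have hk2 : A ^ 2 + A ^ 4 + 2 ≤ k * ρ ^ 2 := by
    rw [hk, add_mul, div_mul_cancel₀ _ (by positivity)]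
    nlinarith [sq_nonneg ρ]
  have hkpos : 0 < k := by linarith
  -- On this sublevel set |P₁ + ρ| and |V₁| are at most ρ/(8k), which gives both smallness
  -- conditions of `lyapunov_decrease`.
  refine isOpen_stableManifold_of_lyapunov (L := lyapunov k ρ) (m := 1) (η := (ρ / (8 * k)) ^ 2)
    (c := ρ) (contDiff_attractedField A)
    (fun x => (hasFDerivAt_lyapunov k ρ x).choose_spec.1.differentiableAt) ?_ one_pos
    (by positivity) hρ (fun x => ?_) (fun x hx => ?_)
  · simp [lyapunov, Eminus, hρdef]
  · have hn : 0 ≤ lyapunov k ρ x := by simp only [lyapunov]; positivity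
    have h2 : x 2 ^ 2 ≤ k * x 2 ^ 2 := le_mul_of_one_le_left (sq_nonneg _) hk1
    have h5 : x 5 ^ 2 ≤ k * x 5 ^ 2 := le_mul_of_one_le_left (sq_nonneg _) hk1
    have h4 : x 4 ^ 2 ≤ k * x 4 ^ 2 := le_mul_of_one_le_left (sq_nonneg _) hk1
    have hle : ‖x - Eminus A‖ ≤ √(lyapunov k ρ x) := by
      rw [pi_norm_le_iff_of_nonneg (Real.sqrt_nonneg _)]
      intro i
      refine Real.abs_le_sqrt ?_
      have := sq_nonneg (x 0)
      have := sq_nonneg (x 1 + ρ)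
      have := sq_nonneg (x 2)
      have := sq_nonneg (x 3)
      have := sq_nonneg (x 4)
      have := sq_nonneg (x 5)
      fin_cases i <;> simp [Eminus, lyapunov] <;> linarith
    have := pow_le_pow_left₀ (norm_nonneg _) hle 2
    rw [Real.sq_sqrt hn] at this
    linarith
  · obtain ⟨L', hL', hv⟩ := hasFDerivAt_lyapunov k ρ x
    rw [hL'.fderiv, hv]
    have n0 := sq_nonneg (x 0)
    have n1 := sq_nonneg (x 1 + ρ)
    have n2 := sq_nonneg (x 2)
    have n3 := sq_nonneg (x 3)
    have n4 := mul_nonneg hkpos.le (sq_nonneg (x 4))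
    have n5 := mul_nonneg hkpos.le (sq_nonneg (x 5))
    have n2' : x 2 ^ 2 ≤ k * x 2 ^ 2 := le_mul_of_one_le_left (sq_nonneg _) hk1
    simp only [lyapunov] at hx
    have hpos : 0 ≤ ρ / (8 * k) := by positivity
    have hp : |x 1 + ρ| ≤ ρ / (8 * k) := abs_le_of_sq_le_sq (by linarith) hpos
    have hV : |x 2| ≤ ρ / (8 * k) := abs_le_of_sq_le_sq (by linarith) hpos
    have hk8 : k * (ρ / (8 * k)) = ρ / 8 := by field_simp
    have hp' : |x 1 + ρ| ≤ ρ / 8 := by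
      refine hp.trans ?_
      rw [← hk8]
      exact le_mul_of_one_le_left hpos hk1
    have hV' : k * |x 2| ≤ ρ / 8 := by
      rw [← hk8]
      exact mul_le_mul_of_nonneg_left hV hkpos.le
    have := lyapunov_decrease (r := x 0) (Q := x 3) (e := x 4) (B := x 5) hρ hk1 hk2 hp' hV'
    simp only [add_sub_cancel_right, ← hr] at this
    simpa [attractedField, lyapunov] using this

/-- Since r₁' = -P₁r₁/2 and P₁ → -ρ, convergence forces r₁ = 0. The hyperplane r₁ = 0 is invariant
for the modified field, and there the two fields agree. -/
theorem stableManifold_Eminus {A : ℝ} (hA : 0 < A) :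
    stableManifold (chartField A) (Eminus A) =
      (coordSubspace {1, 2, 3, 4, 5} : Set Space6) ∩
        stableManifold (attractedField A) (Eminus A) := by
  have hρ := rho_pos hA
  have hmem : ∀ x : Space6, x ∈ (coordSubspace {1, 2, 3, 4, 5} : Set Space6) ↔ x 0 = 0 := by
    intro x
    refine ⟨fun h => h 0 (by decide), fun h i hi => ?_⟩
    fin_cases i
    · exact h
    all_goals exact absurd (by decide) hi
  ext x
  constructor
  · rintro ⟨γ, h0, hγ, hlim⟩
    have hl1 : Tendsto (fun t => γ t 1) atTop (𝓝 (-rho A)) := tendsto_pi_nhds.1 hlim 1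
    have hneg : ∀ᶠ t in atTop, γ t 1 < 0 := hl1.eventually_lt_const (by linarith)
    have z0 : ∀ t ∈ Ici (0 : ℝ), γ t 0 = 0 := eq_zero_of_tendsto_of_eventually_nonneg
      (c := fun t => -(1 / 2) * γ t 1)
      (fun u hu => (hγ.coord 0 hu).congr_deriv (by
        simp only [chartField_0]; ring))
      (continuousOn_const.mul (hγ.continuousOn_coord 1))
      (hneg.mono fun t ht => by linarith) (tendsto_pi_nhds.1 hlim 0)
    refine ⟨(hmem x).2 (h0 ▸ z0 0 self_mem_Ici), γ, h0, fun t ht => ?_, hlim⟩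
    rw [attractedField_eq_chartField (z0 t ht)]
    exact hγ t ht
  · rintro ⟨hx, γ, h0, hγ, hlim⟩
    have z0 : ∀ t ∈ Ici (0 : ℝ), γ t 0 = 0 := eq_zero_of_hasDerivWithinAt_mul ordConnected_Ici
      (hγ.continuousOn_coord 1) (fun u hu => (hγ.coord 0 hu).congr_deriv (mul_comm _ _))
      (self_mem_Ici (a := (0 : ℝ))) (by rw [h0]; exact (hmem x).1 hx)
    refine ⟨γ, h0, fun t ht => ?_, hlim⟩
    rw [← attractedField_eq_chartField (z0 t ht)]
    exact hγ t ht

theorem mem_stableManifold_self {X : Space6 → Space6} {p : Space6} (hp : X p = 0) :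
    p ∈ stableManifold X p :=
  ⟨fun _ => p, rfl, fun t _ => by simpa [hp] using hasDerivWithinAt_const t (Ici (0 : ℝ)) p,
    tendsto_const_nhds⟩

theorem isSmoothSubmanifold_stableManifold_Eminus {A : ℝ} (hA : 0 < A) :
    IsSmoothSubmanifold 5 (stableManifold (chartField A) (Eminus A)) := by
  have hne : (stableManifold (chartField A) (Eminus A)).Nonempty :=
    ⟨_, mem_stableManifold_self (isIsolatedEquilibrium_chartField hA (Eminus_mem_lineI A)
      (by simp [Eminus])).1⟩
  rw [stableManifold_Eminus hA] at hne ⊢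
  exact isSmoothSubmanifold_coordSubspace_inter (isOpen_stableManifold_attractedField hA) hne

theorem isSmoothSubmanifold_invariantManifolds {A : ℝ} (hA : 0 < A) :
    IsSmoothSubmanifold 1 (stableManifold (chartField A) (Eplus A)) ∧
      IsSmoothSubmanifold 5 (unstableManifold (chartField A) (Eplus A)) ∧
      IsSmoothSubmanifold 1 (unstableManifold (chartField A) (Eminus A)) ∧
      IsSmoothSubmanifold 5 (stableManifold (chartField A) (Eminus A)) := by
  have hrev : ∀ p, unstableManifold (chartField A) p =
      reflectionEquiv ⁻¹' stableManifold (chartField A) (reflection p) :=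
    unstableManifold_eq_preimage (R := reflectionEquiv) (chartField_reflection A)
      reflection_reflection
  refine ⟨isSmoothSubmanifold_stableManifold_Eplus hA, ?_, ?_,
    isSmoothSubmanifold_stableManifold_Eminus hA⟩
  · rw [hrev, reflection_Eplus]
    exact (isSmoothSubmanifold_stableManifold_Eminus hA).preimage _
  · rw [hrev, reflection_Eminus]
    exact (isSmoothSubmanifold_stableManifold_Eplus hA).preimage _

/-! ### The manifold `𝒱₁` -/

section
variable {A : ℝ} {x : Space6}

/-- The graph map of `𝒱₁` over the coordinates `r₁, Q₁, ℬ₁`. -/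
noncomputable def graphV1 (A : ℝ) (y : Space6) : Space6 :=
  ![y 0, 0, -(1 - A * y 5 * (A - y 0 ^ 2)) / (A * (A - y 0 ^ 2) ^ 2), y 3, 0, y 5]

theorem manifoldV1_eq_graph (A : ℝ) :
    manifoldV1 A = {y | y ∈ {y : Space6 | y 0 ^ 2 ≠ A} ∧ graphV1 A y = y} := by
  ext y
  constructor
  · rintro ⟨h, h1, h2, h4⟩
    refine ⟨h, ?_⟩
    ext i
    fin_cases i
    exacts [rfl, h1.symm, h2.symm, rfl, h4.symm, rfl]
  · rintro ⟨h, hy⟩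
    exact ⟨h, (congrFun hy 1).symm, (congrFun hy 2).symm, (congrFun hy 4).symm⟩

theorem isOpen_sq_ne (A : ℝ) : IsOpen {y : Space6 | y 0 ^ 2 ≠ A} :=
  isOpen_ne_fun ((continuous_apply 0).pow 2) continuous_const

theorem contDiffOn_graphV1 (hA : 0 < A) :
    ContDiffOn ℝ ∞ (graphV1 A) {y : Space6 | y 0 ^ 2 ≠ A} := by
  have h : ∀ i : Fin 6, ContDiffOn ℝ ∞ (fun y : Space6 => y i) {y : Space6 | y 0 ^ 2 ≠ A} :=
    fun i => (contDiff_apply ℝ ℝ i).contDiffOn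
  have hu : ContDiffOn ℝ ∞ (fun y : Space6 => A - y 0 ^ 2) {y : Space6 | y 0 ^ 2 ≠ A} :=
    contDiffOn_const.sub ((h 0).pow 2)
  refine contDiffOn_pi.2 fun i => ?_
  fin_cases i
  · exact h 0
  · exact contDiffOn_const
  · refine ((contDiffOn_const.sub ((contDiffOn_const.mul (h 5)).mul hu)).neg).div
      (contDiffOn_const.mul (hu.pow 2)) fun y hy => ?_
    exact mul_ne_zero hA.ne' (pow_ne_zero 2 (sub_ne_zero.2 (Ne.symm hy)))
  · exact h 3
  · exact contDiffOn_const
  · exact h 5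

theorem graphV1_congr (A : ℝ) (y z : Space6) (h : ∀ i ∈ ({0, 3, 5} : Finset (Fin 6)), y i = z i) :
    graphV1 A y = graphV1 A z := by
  simp only [graphV1, h 0 (by decide), h 3 (by decide), h 5 (by decide)]

theorem sq_ne_congr (A : ℝ) (y z : Space6) (h : ∀ i ∈ ({0, 3, 5} : Finset (Fin 6)), y i = z i)
    (hy : y ∈ {y : Space6 | y 0 ^ 2 ≠ A}) : z ∈ {y : Space6 | y 0 ^ 2 ≠ A} := by
  simpa only [mem_ofPred_eq, h 0 (by decide)] using hy

theorem graphV1_apply (A : ℝ) (y : Space6) (i : Fin 6) (hi : i ∈ ({0, 3, 5} : Finset (Fin 6))) :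
    graphV1 A y i = y i := by
  fin_cases i
  · rfl
  · exact absurd hi (by decide)
  · exact absurd hi (by decide)
  · rfl
  · exact absurd hi (by decide)
  · rfl

theorem lineL1_subset (hA : 0 < A) : lineL1 A ⊆ manifoldV1 A := by
  rintro y ⟨h0, h1, h2, h4, h5⟩
  refine ⟨by simp [h0, hA.ne], h1, ?_, h4⟩
  rw [h2, h0, h5]
  ring

theorem lineL1_eq (hA : 0 < A) : lineL1 A = {x ∈ manifoldV1 A | x 0 = 0 ∧ x 5 = 0} := by
  ext y
  constructor
  · exact fun h => ⟨lineL1_subset hA h, h.1, h.2.2.2.2⟩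
  · rintro ⟨⟨-, h1, h2, h4⟩, h0, h5⟩
    refine ⟨h0, h1, ?_, h4, h5⟩
    rw [h2, h0, h5]
    ring

theorem isSmoothSubmanifold_manifoldV1 (hA : 0 < A) : IsSmoothSubmanifold 3 (manifoldV1 A) := by
  have hne : (manifoldV1 A).Nonempty :=
    ⟨![0, 0, -1 / A ^ 3, 0, 0, 0], lineL1_subset hA (by simp [lineL1])⟩
  rw [manifoldV1_eq_graph] at hne ⊢
  exact isSmoothSubmanifold_graph (s := {0, 3, 5}) (isOpen_sq_ne A) (contDiffOn_graphV1 hA)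
    (graphV1_congr A) (sq_ne_congr A) (fun y _ => graphV1_apply A y) hne

theorem u_ne_zero (hx : x ∈ manifoldV1 A) : A - x 0 ^ 2 ≠ 0 := sub_ne_zero.2 hx.1.symm

theorem V_mul_sq (hA : 0 < A) (hx : x ∈ manifoldV1 A) :
    x 2 * (A - x 0 ^ 2) ^ 2 = x 5 * (A - x 0 ^ 2) - 1 / A := by
  have hu := u_ne_zero hx
  rw [hx.2.2.1]
  field_simp
  ring

theorem chartG_eq_zero (hA : 0 < A) (hx : x ∈ manifoldV1 A) : chartG A x = 0 := by
  rw [chartG_eq, V_mul_sq hA hx]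
  ring

theorem chartField_eq_zero (hA : 0 < A) (hx : x ∈ manifoldV1 A) : chartField A x = 0 := by
  have hG := chartG_eq_zero hA hx
  ext i
  fin_cases i <;> simp [chartField, hG, hx.2.1, hx.2.2.2]

theorem Lam_mul (hx : x ∈ manifoldV1 A) :
    Lam A x * (A - x 0 ^ 2) = 2 - x 0 ^ 2 * (A - x 0 ^ 2) * x 5 :=
  div_mul_cancel₀ _ (u_ne_zero hx)

/-! ### The linearization on `𝒱₁` -/

/-- The derivative of `chartG` at `x` in the direction `w`. -/
def chartGDeriv (A : ℝ) (x w : Space6) : ℝ :=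
  w 5 * (A - x 0 ^ 2) - w 2 * (A - x 0 ^ 2) ^ 2 + 2 * x 0 * (2 * x 2 * (A - x 0 ^ 2) - x 5) * w 0

theorem hasDerivAt_line (x w : Space6) (i : Fin 6) :
    HasDerivAt (fun t : ℝ => (x + t • w) i) (w i) 0 := by
  simpa using ((hasDerivAt_id (0 : ℝ)).mul_const (w i)).const_add (x i)

theorem hasDerivAt_line' (x w : Space6) : HasDerivAt (fun t : ℝ => x + t • w) w 0 :=
  hasDerivAt_pi.2 (hasDerivAt_line x w)

theorem fderiv_apply_eq_of_line {f : Space6 → Space6} {x w v : Space6}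
    (hf : DifferentiableAt ℝ f x) (h : ∀ i, HasDerivAt (fun t : ℝ => f (x + t • w) i) (v i) 0) :
    fderiv ℝ f x w = v := by
  have h1 : HasFDerivAt f (fderiv ℝ f x) (x + (0 : ℝ) • w) := by simpa using hf.hasFDerivAt
  exact (h1.comp_hasDerivAt 0 (hasDerivAt_line' x w)).unique (hasDerivAt_pi.2 h)

theorem hasDerivAt_chartG_line (A : ℝ) (x w : Space6) :
    HasDerivAt (fun t : ℝ => chartG A (x + t • w)) (chartGDeriv A x w) 0 := by
  have h := hasDerivAt_line x w
  simp only [chartG_eq]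
  have hu := ((h 0).pow 2).const_sub A
  refine ((((h 5).mul hu).sub ((h 2).mul (hu.pow 2))).sub_const (1 / A)).congr_deriv ?_
  simp [chartGDeriv]
  ring

theorem contDiff_chartField (A : ℝ) : ContDiff ℝ ∞ (chartField A) := by
  have h : ∀ i : Fin 6, ContDiff ℝ ∞ (fun x : Space6 => x i) := fun i => contDiff_apply ℝ ℝ i
  have hG : ContDiff ℝ ∞ (chartG A) :=
    (((contDiff_const.mul (h 5)).sub (contDiff_const.mul (h 2))).sub contDiff_const).sub
      (((h 0).pow 2).mul (((h 5).sub (contDiff_const.mul (h 2))).add (((h 0).pow 2).mul (h 2))))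
  refine contDiff_pi.2 fun i => ?_
  fin_cases i
  · exact (contDiff_const.mul (h 0)).mul (h 1)
  · exact (contDiff_const.mul ((h 1).pow 2)).add hG
  · exact ((contDiff_const.mul (h 1)).mul (h 2)).add ((h 4).mul (h 3))
  · exact (((contDiff_const.mul (h 1)).mul (h 3)).sub (h 4)).sub ((((h 0).pow 2).mul (h 4)).mul hG)
  · exact (h 4).mul (h 1)
  · exact (contDiff_const.mul (h 5)).mul (h 1)

theorem jacobian_apply (hA : 0 < A) (hx : x ∈ manifoldV1 A) (w : Space6) :
    jacobian (chartField A) x w =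
      ![-(1 / 2) * x 0 * w 1, chartGDeriv A x w, 2 * x 2 * w 1 + x 3 * w 4,
        3 / 2 * x 3 * w 1 - w 4, 0, 2 * x 5 * w 1] := by
  have h := hasDerivAt_line x w
  have hg := hasDerivAt_chartG_line A x w
  have hG := chartG_eq_zero hA hx
  have h1 := hx.2.1
  have h4 := hx.2.2.2
  refine fderiv_apply_eq_of_line ((contDiff_chartField A).differentiable (by simp) x) fun i => ?_
  fin_cases i
  · refine (((h 0).const_mul (-(1 / 2))).mul (h 1)).congr_deriv ?_
    simp [h1]
  · refine ((((h 1).pow 2).const_mul (3 / 2)).add hg).congr_deriv ?_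
    simp [h1]
  · refine ((((h 1).const_mul 2).mul (h 2)).add ((h 4).mul (h 3))).congr_deriv ?_
    simp [h1, h4]
    ring
  · refine (((((h 1).const_mul (3 / 2)).mul (h 3)).sub (h 4)).sub
      ((((h 0).pow 2).mul (h 4)).mul hg)).congr_deriv ?_
    simp [h1, h4, hG]
    ring
  · refine ((h 4).mul (h 1)).congr_deriv ?_
    simp [h1, h4]
  · refine (((h 5).const_mul 2).mul (h 1)).congr_deriv ?_
    simp [h1]

/-- The derivative of `chartG` along the image of the `P₁`-direction is `Λ`. -/
theorem chartGDeriv_eq_Lam (hA : 0 < A) (hx : x ∈ manifoldV1 A) :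
    2 * x 5 * (A - x 0 ^ 2) - 2 * x 2 * (A - x 0 ^ 2) ^ 2 +
      2 * x 0 * (2 * x 2 * (A - x 0 ^ 2) - x 5) * (-(1 / 2) * x 0) = Lam A x := by
  have hu := u_ne_zero hx
  have hV := V_mul_sq hA hx
  have hL := Lam_mul hx
  have h1 : A * (x 2 * (A - x 0 ^ 2) ^ 2) = A * x 5 * (A - x 0 ^ 2) - 1 := by
    rw [hV]; field_simp
  refine mul_right_cancel₀ hu ?_
  rw [hL]
  linear_combination (-2) * h1

/-- The ε₁-row of L vanishes, so w 4 = 0, and the other rows except that of P₁ express the entries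
as multiples of w 1 / ν. The P₁-row is then ν² = Λ. -/
theorem mem_eigenspace_iff_exists (hA : 0 < A) (hx : x ∈ manifoldV1 A) {ν : ℝ} (hν : ν ≠ 0)
    (hν2 : ν ^ 2 = Lam A x) (w : Space6) :
    w ∈ (jacobian (chartField A) x).eigenspace ν ↔
      ∃ a : ℝ, w = a • (![-(1 / 2) * x 0, ν, 2 * x 2, 3 / 2 * x 3, 0, 2 * x 5] : Space6) := by
  rw [Module.End.mem_eigenspace_iff, jacobian_apply hA hx]
  constructor
  · intro h
    have e0 : -(1 / 2) * x 0 * w 1 = ν * w 0 := congrFun h 0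
    have e2 : 2 * x 2 * w 1 + x 3 * w 4 = ν * w 2 := congrFun h 2
    have e3 : 3 / 2 * x 3 * w 1 - w 4 = ν * w 3 := congrFun h 3
    have e4 : 0 = ν * w 4 := congrFun h 4
    have e5 : 2 * x 5 * w 1 = ν * w 5 := congrFun h 5
    have h4 : w 4 = 0 := by simpa [hν] using e4.symm
    rw [h4, mul_zero, add_zero] at e2
    rw [h4, sub_zero] at e3
    refine ⟨w 1 / ν, ?_⟩
    have key : ∀ b c : ℝ, c * w 1 = ν * b → b = w 1 / ν * c := fun b c h => by
      field_simp
      linarith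
    ext i
    fin_cases i
    · exact key _ _ e0
    · exact key _ _ rfl
    · exact key _ _ e2
    · exact key _ _ e3
    · exact key _ _ ((zero_mul _).trans e4)
    · exact key _ _ e5
  · rintro ⟨a, rfl⟩
    have hL := chartGDeriv_eq_Lam hA hx
    rw [← hν2] at hL
    ext i
    fin_cases i <;> simp [chartGDeriv] <;> ring_nf
    linear_combination a * hL

theorem hasEigenvalue_iff (hA : 0 < A) (hx : x ∈ manifoldV1 A) (μ : ℝ) :
    (jacobian (chartField A) x).HasEigenvalue μ ↔ μ = 0 ∨ μ ^ 2 = Lam A x := by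
  have zero : (jacobian (chartField A) x).HasEigenvalue 0 := by
    -- The Q₁-direction is tangent to 𝒱₁ everywhere.
    refine Module.End.hasEigenvalue_of_hasEigenvector (x := (![0, 0, 0, 1, 0, 0] : Space6))
      ⟨Module.End.mem_eigenspace_iff.2 ?_, fun h => ?_⟩
    · rw [jacobian_apply hA hx]
      ext i
      fin_cases i <;> simp [chartGDeriv]
    · simpa using congrFun h 3
  by_cases hμ : μ = 0
  · subst hμ
    simpa using zero
  simp only [hμ, false_or]
  constructor
  · intro h
    obtain ⟨w, hw, hw0⟩ := h.exists_hasEigenvector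
    rw [Module.End.mem_eigenspace_iff, jacobian_apply hA hx] at hw
    have e0 : -(1 / 2) * x 0 * w 1 = μ * w 0 := congrFun hw 0
    have e1 : chartGDeriv A x w = μ * w 1 := congrFun hw 1
    have e2 : 2 * x 2 * w 1 + x 3 * w 4 = μ * w 2 := congrFun hw 2
    have e3 : 3 / 2 * x 3 * w 1 - w 4 = μ * w 3 := congrFun hw 3
    have e4 : 0 = μ * w 4 := congrFun hw 4
    have e5 : 2 * x 5 * w 1 = μ * w 5 := congrFun hw 5
    have h4 : w 4 = 0 := by simpa [hμ] using e4.symm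
    rw [h4] at e2 e3
    have h1 : w 1 ≠ 0 := by
      intro h1
      rw [h1] at e0 e2 e3 e5
      refine hw0 ?_
      ext i
      fin_cases i <;> simp [h1, h4] <;> refine (mul_eq_zero.1 ?_).resolve_left hμ <;> linarith
    have hL := chartGDeriv_eq_Lam hA hx
    refine mul_right_cancel₀ h1 ?_
    simp only [chartGDeriv] at e1
    rw [← hL]
    linear_combination (-μ) * e1 - (A - x 0 ^ 2) * e5 + (A - x 0 ^ 2) ^ 2 * e2 -
      2 * x 0 * (2 * x 2 * (A - x 0 ^ 2) - x 5) * e0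
  · intro h
    refine Module.End.hasEigenvalue_of_hasEigenvector
      (x := (![-(1 / 2) * x 0, μ, 2 * x 2, 3 / 2 * x 3, 0, 2 * x 5] : Space6))
      ⟨(mem_eigenspace_iff_exists hA hx hμ h _).2 ⟨1, (one_smul _ _).symm⟩, fun h0 => hμ ?_⟩
    simpa using congrFun h0 1

/-! ### The tangent space of `𝒱₁` and the neutral fibers -/

/-- The tangent space of `𝒱₁` at `x`. -/
def tangentV1 (A : ℝ) (x : Space6) : Submodule ℝ Space6 where
  carrier := {w | w 1 = 0 ∧ w 4 = 0 ∧ chartGDeriv A x w = 0}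
  add_mem' := by
    rintro a b ⟨a1, a4, aG⟩ ⟨b1, b4, bG⟩
    refine ⟨by simp [a1, b1], by simp [a4, b4], ?_⟩
    simp only [chartGDeriv, Pi.add_apply] at *
    linear_combination aG + bG
  zero_mem' := by simp [chartGDeriv]
  smul_mem' := by
    rintro c a ⟨a1, a4, aG⟩
    refine ⟨by simp [a1], by simp [a4], ?_⟩
    simp only [chartGDeriv, Pi.smul_apply, smul_eq_mul] at *
    linear_combination c * aG

theorem mem_tangentV1 {w : Space6} :
    w ∈ tangentV1 A x ↔ w 1 = 0 ∧ w 4 = 0 ∧ chartGDeriv A x w = 0 := Iff.rfl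

theorem fderiv_graphV1 (hA : 0 < A) (hx : x ∈ manifoldV1 A) (w : Space6) :
    fderiv ℝ (graphV1 A) x w =
      ![w 0, 0, (w 5 * (A - x 0 ^ 2) + 2 * x 0 * (2 * x 2 * (A - x 0 ^ 2) - x 5) * w 0) /
        (A - x 0 ^ 2) ^ 2, w 3, 0, w 5] := by
  have h := hasDerivAt_line x w
  have hu := u_ne_zero hx
  refine fderiv_apply_eq_of_line (((contDiffOn_graphV1 hA).contDiffAt
    ((isOpen_sq_ne A).mem_nhds hx.1)).differentiableAt (by simp)) fun i => ?_
  fin_cases i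
  · exact h 0
  · exact hasDerivAt_const _ _
  · have h2 := ((h 0).pow 2).const_sub A
    refine (((((h 5).const_mul A).mul h2).const_sub 1).neg.div ((h2.pow 2).const_mul A)
      (by simpa using ⟨hA.ne', hu⟩)).congr_deriv ?_
    simp [hx.2.2.1]
    field_simp
    ring
  · exact h 3
  · exact hasDerivAt_const _ _
  · exact h 5

theorem coe_tangentV1 (hA : 0 < A) (hx : x ∈ manifoldV1 A) :
    (tangentV1 A x : Set Space6) = tangentVectors (manifoldV1 A) x := by
  have hu := u_ne_zero hx
  have hx' := hx
  rw [manifoldV1_eq_graph] at hx'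
  rw [manifoldV1_eq_graph, tangentVectors_graph (s := {0, 3, 5}) (isOpen_sq_ne A) (graphV1_congr A)
    (sq_ne_congr A) (fun y _ => graphV1_apply A y) hx'.1 hx'.2
    (((contDiffOn_graphV1 hA).contDiffAt
      ((isOpen_sq_ne A).mem_nhds hx.1)).differentiableAt (by simp)).hasFDerivAt]
  ext w
  rw [SetLike.mem_coe, mem_tangentV1, mem_ofPred_eq, fderiv_graphV1 hA hx]
  constructor
  · rintro ⟨h1, h4, hG⟩
    ext i
    fin_cases i <;> simp [h1, h4]
    rw [div_eq_iff (pow_ne_zero 2 hu)]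
    simp only [chartGDeriv] at hG
    linarith
  · intro h
    refine ⟨(congrFun h 1).symm, (congrFun h 4).symm, ?_⟩
    have h2 := congrFun h 2
    simp only [Fin.isValue, Matrix.cons_val] at h2
    rw [div_eq_iff (pow_ne_zero 2 hu)] at h2
    simp only [chartGDeriv]
    linarith

theorem finrank_tangentV1 (hx : x ∈ manifoldV1 A) : Module.finrank ℝ (tangentV1 A x) = 3 := by
  have hu := u_ne_zero hx
  let e : tangentV1 A x ≃ₗ[ℝ] (Fin 3 → ℝ) :=
    { toFun := fun w => ![w.1 0, w.1 3, w.1 5]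
      map_add' := fun a b => by
        ext i
        fin_cases i <;> simp
      map_smul' := fun a b => by
        ext i
        fin_cases i <;> simp
      invFun := fun v => ⟨![v 0, 0, (v 2 * (A - x 0 ^ 2) +
        2 * x 0 * (2 * x 2 * (A - x 0 ^ 2) - x 5) * v 0) / (A - x 0 ^ 2) ^ 2, v 1, 0, v 2], by
          refine ⟨rfl, rfl, ?_⟩
          simp [chartGDeriv]
          field_simp
          ring⟩
      left_inv := fun w => by
        obtain ⟨w, h1, h4, hG⟩ := w
        ext i
        fin_cases i <;> simp [h1, h4]
        rw [div_eq_iff (pow_ne_zero 2 hu)]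
        simp only [chartGDeriv] at hG
        linarith
      right_inv := fun v => by
        ext i
        fin_cases i <;> simp }
  rw [e.finrank_eq, Module.finrank_fin_fun]

/-- The spanning vector of the neutral fiber. -/
noncomputable def neutralVector (A : ℝ) (x : Space6) : Space6 :=
  ![0, x 3 * (A - x 0 ^ 2) ^ 2, 0, 0, Lam A x, 0]

theorem mem_neutralFiber {w : Space6} :
    w ∈ neutralFiber A x ↔ ∃ a : ℝ, a • neutralVector A x = w :=
  Submodule.mem_span_singleton

theorem tangentV1_le_ker (hA : 0 < A) (hx : x ∈ manifoldV1 A) :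
    tangentV1 A x ≤ LinearMap.ker (jacobian (chartField A) x) := by
  rintro w ⟨h1, h4, hG⟩
  rw [LinearMap.mem_ker, jacobian_apply hA hx, h1, h4, hG]
  ext i
  fin_cases i <;> simp

theorem tangentV1_inf_neutralFiber (hL : Lam A x ≠ 0) : tangentV1 A x ⊓ neutralFiber A x = ⊥ := by
  rw [eq_bot_iff]
  rintro w ⟨⟨-, h4, -⟩, hw⟩
  obtain ⟨a, rfl⟩ := mem_neutralFiber.1 hw
  have : a = 0 := by simpa [neutralVector, hL] using h4
  simp [this]

theorem finrank_neutralFiber (hL : Lam A x ≠ 0) : Module.finrank ℝ (neutralFiber A x) = 1 := by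
  refine finrank_span_singleton fun h => hL ?_
  simpa using congrFun h 4

theorem jacobian_neutral_mem (hA : 0 < A) (hx : x ∈ manifoldV1 A) {w : Space6}
    (hw : w ∈ neutralFiber A x) : jacobian (chartField A) x w ∈ tangentV1 A x := by
  obtain ⟨a, rfl⟩ := mem_neutralFiber.1 hw
  have hL := chartGDeriv_eq_Lam hA hx
  rw [jacobian_apply hA hx]
  refine ⟨?_, rfl, ?_⟩
  · simp [chartGDeriv, neutralVector]
  · simp [chartGDeriv, neutralVector]
    linear_combination a * (x 3 * (A - x 0 ^ 2) ^ 2) * hL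

/-- Subtracting the multiple of the neutral vector with the same ε₁-entry leaves a tangent vector
exactly under these two linear equations. -/
theorem mem_tangent_sup_neutral_iff (hL : Lam A x ≠ 0) {w : Space6} :
    w ∈ tangentV1 A x ⊔ neutralFiber A x ↔
      Lam A x * w 1 = x 3 * (A - x 0 ^ 2) ^ 2 * w 4 ∧ chartGDeriv A x w = 0 := by
  rw [Submodule.mem_sup]
  constructor
  · rintro ⟨v, ⟨h1, h4, hG⟩, n, hn, rfl⟩
    obtain ⟨a, rfl⟩ := mem_neutralFiber.1 hn
    refine ⟨?_, ?_⟩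
    · simp [neutralVector, h1, h4]
      ring
    · simpa [chartGDeriv, neutralVector] using hG
  · rintro ⟨h, hG⟩
    refine ⟨w - (w 4 / Lam A x) • neutralVector A x, ⟨?_, ?_, ?_⟩,
      (w 4 / Lam A x) • neutralVector A x, mem_neutralFiber.2 ⟨_, rfl⟩, by simp⟩
    · simp [neutralVector]
      field_simp
      linarith
    · simp [neutralVector, hL]
    · simpa [chartGDeriv, neutralVector] using hG

/-- As Lw has no ε₁-entry, the hypothesis says dG(w) = 0 and dG(Lw) = 0, and dG(Lw) = Λ w₁ - Q₁(A -
r₁²)² w₄ is the remaining defining equation for w. -/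
theorem mem_sup_of_jacobian_mem_sup (hA : 0 < A) (hx : x ∈ manifoldV1 A) (hL : Lam A x ≠ 0)
    {w : Space6} (h : jacobian (chartField A) x w ∈ tangentV1 A x ⊔ neutralFiber A x) :
    w ∈ tangentV1 A x ⊔ neutralFiber A x := by
  rw [mem_tangent_sup_neutral_iff hL, jacobian_apply hA hx] at h
  obtain ⟨h1, h2⟩ := h
  have hE := chartGDeriv_eq_Lam hA hx
  have hG : chartGDeriv A x w = 0 := by simpa [hL] using h1
  refine (mem_tangent_sup_neutral_iff hL).2 ⟨?_, hG⟩
  simp only [chartGDeriv, Fin.isValue, Matrix.cons_val] at h2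
  linear_combination h2 - w 1 * hE

theorem tangent_sup_neutral_eq (hA : 0 < A) (hx : x ∈ manifoldV1 A) (hL : Lam A x ≠ 0) :
    tangentV1 A x ⊔ neutralFiber A x = (jacobian (chartField A) x).maxGenEigenspace 0 := by
  refine le_antisymm (sup_le ?_ ?_) ?_
  · intro w hw
    exact (Module.End.mem_maxGenEigenspace _ _ _).2
      ⟨1, by simpa using tangentV1_le_ker hA hx hw⟩
  · intro w hw
    refine (Module.End.mem_maxGenEigenspace _ _ _).2 ⟨2, ?_⟩
    have := tangentV1_le_ker hA hx (jacobian_neutral_mem hA hx hw)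
    simpa [pow_two] using this
  · intro w hw
    obtain ⟨k, hk⟩ := (Module.End.mem_maxGenEigenspace _ _ _).1 hw
    rw [zero_smul, sub_zero] at hk
    clear hw
    -- Powers of L are stripped one at a time, the sum being closed under preimages by L.
    induction k generalizing w with
    | zero =>
      have : w = 0 := by simpa using hk
      rw [this]
      exact Submodule.zero_mem _
    | succ k ih =>
      rw [pow_succ, Module.End.mul_apply] at hk
      exact mem_sup_of_jacobian_mem_sup hA hx hL (ih hk)

/-- The exponential series applied to w stops after its linear term. -/
theorem exp_smul_apply_of_sq_eq_zero (L : Space6 →L[ℝ] Space6) {w : Space6} (h : L (L w) = 0)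
    (t : ℝ) : NormedSpace.exp (t • L) w = w + t • L w := by
  have hs := NormedSpace.exp_series_hasSum_exp' (𝕂 := ℝ) (t • L)
  have h1 := (ContinuousLinearMap.apply ℝ Space6 w).hasSum hs
  have hz : ∀ n ∉ Finset.range 2, (ContinuousLinearMap.apply ℝ Space6 w)
      ((n.factorial : ℝ)⁻¹ • (t • L) ^ n) = 0 := by
    intro n hn
    obtain ⟨m, rfl⟩ : ∃ m, n = m + 2 := ⟨n - 2, by simp at hn; omega⟩
    have h2 : ((t • L) ^ 2) w = 0 := by simp [pow_two, h]
    change (((m + 2).factorial : ℝ)⁻¹ • (t • L) ^ (m + 2)) w = 0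
    rw [smul_apply, pow_add, mul_apply_eq_comp, h2, map_zero, smul_zero]
  have h2 := h1.unique (hasSum_sum_of_ne_finset_zero hz)
  simpa [Finset.sum_range_succ] using h2

theorem pointP_mem (hA : 0 < A) (s : ℝ) : pointP A s ∈ manifoldV1 A :=
  lineL1_subset hA (by simp [lineL1, pointP])

theorem sq_two_div_sqrt (hA : 0 < A) : (2 / √(3 * A ^ 3)) ^ 2 = 4 / (3 * A ^ 3) := by
  rw [div_pow, Real.sq_sqrt (by positivity)]
  norm_num

/-- A kernel vector that is not tangent has w 1 ≠ 0. This forces r₁ = ℬ₁ = 0, hence V₁ = -A⁻³, and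
eliminating w 4 leaves 2V₁ + (3/2)Q₁² = 0. -/
theorem eq_pointP_of_mem_ker (hA : 0 < A) (hx : x ∈ manifoldV1 A) {w : Space6}
    (hw : w ∈ LinearMap.ker (jacobian (chartField A) x)) (hT : w ∉ tangentV1 A x) :
    x = pointP A 1 ∨ x = pointP A (-1) := by
  rw [LinearMap.mem_ker, jacobian_apply hA hx] at hw
  have e0 : -(1 / 2) * x 0 * w 1 = 0 := congrFun hw 0
  have e1 : chartGDeriv A x w = 0 := congrFun hw 1
  have e2 : 2 * x 2 * w 1 + x 3 * w 4 = 0 := congrFun hw 2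
  have e3 : 3 / 2 * x 3 * w 1 - w 4 = 0 := congrFun hw 3
  have e5 : 2 * x 5 * w 1 = 0 := congrFun hw 5
  have h1 : w 1 ≠ 0 := fun h1 => hT ⟨h1, by rw [h1] at e3; linarith, e1⟩
  have h0 : x 0 = 0 := by simpa [h1] using e0
  have h5 : x 5 = 0 := by simpa [h1] using e5
  have hl : x ∈ lineL1 A := by
    rw [lineL1_eq hA]
    exact ⟨hx, h0, h5⟩
  obtain ⟨-, hx1, hx2, hx4, -⟩ := hl
  have h3 : x 3 ^ 2 = (2 / √(3 * A ^ 3)) ^ 2 := by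
    rw [sq_two_div_sqrt hA]
    have : (2 * x 2 + 3 / 2 * x 3 ^ 2) * w 1 = 0 := by linear_combination e2 + x 3 * e3
    have := (mul_eq_zero.1 this).resolve_right h1
    rw [hx2] at this
    have h' : x 3 ^ 2 = 2 / 3 * (2 / A ^ 3) := by
      rw [neg_div] at this
      linear_combination 2 / 3 * this
    rw [h']
    field_simp
    norm_num
  rcases sq_eq_sq_iff_eq_or_eq_neg.1 h3 with h | h
  · right
    ext i
    fin_cases i <;> simp [pointP, h0, hx1, hx2, hx4, h5, h]
  · left
    ext i
    fin_cases i <;> simp [pointP, h0, hx1, hx2, hx4, h5, h]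

/-- With r₁ = 0 and Λ = 2/A the V₁-row cancels for every Q₁; only the Q₁-row needs Q₁² = 4/(3A³). -/
theorem neutralFiber_le_ker_pointP (hA : 0 < A) {s : ℝ} (hs : s ^ 2 = 1) :
    neutralFiber A (pointP A s) ≤ LinearMap.ker (jacobian (chartField A) (pointP A s)) := by
  have hp := pointP_mem hA s
  have h0 : pointP A s 0 = 0 := rfl
  have h2 : pointP A s 2 = -1 / A ^ 3 := rfl
  have h5 : pointP A s 5 = 0 := rfl
  have h3 : pointP A s 3 ^ 2 = 4 / (3 * A ^ 3) := by
    rw [← sq_two_div_sqrt hA, ← one_mul ((2 / √(3 * A ^ 3)) ^ 2), ← hs, ← mul_pow, ← neg_sq]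
    congr 1
    simp [pointP]
  generalize pointP A s = x at *
  have hL : Lam A x = 2 / A := by simp [Lam, h0]
  rw [eq_div_iff (by positivity)] at h3
  intro w hw
  obtain ⟨a, rfl⟩ := mem_neutralFiber.1 hw
  rw [LinearMap.mem_ker, jacobian_apply hA hp]
  ext i
  fin_cases i
  · simp [h0]
  · simp [neutralVector, chartGDeriv, h0]
  · simp [neutralVector, hL, h0, h2]
    field_simp
    ring
  · simp [neutralVector, hL, h0]
    field_simp
    linear_combination a * h3
  · simp
  · simp [h5]

/-! ### The chart map on `𝒱₁` -/

/-- Lets the bijections onto the critical manifold and the saddle sheet be cut out of the one onto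
all layer equilibria, by matching membership conditions. -/
theorem bijOn_of_bijOn_of_iff {α β : Type*} {f : α → β} {S S' : Set α} {T T' : Set β}
    (h : BijOn f S T) (hS : S' ⊆ S) (hT : T' ⊆ T) (hiff : ∀ a ∈ S, a ∈ S' ↔ f a ∈ T') :
    BijOn f S' T' := by
  refine ⟨fun a ha => (hiff a (hS ha)).1 ha, h.injOn.mono hS, fun b hb => ?_⟩
  obtain ⟨a, ha, rfl⟩ := h.surjOn (hT hb)
  exact ⟨a, (hiff a ha).2 hb, rfl⟩

theorem mem_layerEquilibria_iff (hA : 0 < A) {y : Space6} :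
    y ∈ layerEquilibria A ↔
      y 4 = 0 ∧ y 1 = 0 ∧ y 0 ≠ 0 ∧ y 2 = ((y 5 + 1) * y 0 - A) / y 0 ^ 2 := by
  constructor
  · rintro ⟨h4, h⟩
    have h1 : y 1 = 0 := congrFun h 0
    have h2 : -A + (y 5 + 1) * y 0 - y 0 ^ 2 * y 2 = 0 := congrFun h 1
    have h0 : y 0 ≠ 0 := fun h0 => by
      rw [h0] at h2
      exact hA.ne' (by linarith)
    refine ⟨h4, h1, h0, ?_⟩
    rw [eq_div_iff (pow_ne_zero 2 h0)]
    linarith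
  · rintro ⟨h4, h1, h0, h2⟩
    refine ⟨h4, ?_⟩
    rw [eq_div_iff (pow_ne_zero 2 h0)] at h2
    ext i
    fin_cases i <;> simp [spatialField, h1, h4]
    linarith

theorem bijOn_blowDown_layerEquilibria (hA : 0 < A) :
    BijOn (blowDown A) {x ∈ manifoldV1 A | 0 < x 0} {y ∈ layerEquilibria A | y 0 < A} := by
  refine ⟨?_, ?_, ?_⟩
  · rintro x ⟨hx, h0⟩
    have hu := u_ne_zero hx
    refine ⟨(mem_layerEquilibria_iff hA).2
      ⟨by simp [blowDown, hx.2.2.2], by simp [blowDown, hx.2.1], by simpa [blowDown] using hu, ?_⟩,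
      by
        have := pow_pos h0 2
        simp only [blowDown, Matrix.cons_val_zero]
        linarith⟩
    simp only [blowDown, hx.2.2.1, Fin.isValue, Matrix.cons_val]
    field_simp
    ring
  · rintro x ⟨-, hx⟩ y ⟨-, hy⟩ h
    have e0 : A - x 0 ^ 2 = A - y 0 ^ 2 := congrFun h 0
    have h0 : x 0 = y 0 := by
      rw [← Real.sqrt_sq hx.le, ← Real.sqrt_sq hy.le]
      congr 1
      linarith
    have e1 : x 0 ^ 3 * x 1 = y 0 ^ 3 * y 1 := congrFun h 1
    have e2 : 1 / A + x 0 ^ 4 * x 2 = 1 / A + y 0 ^ 4 * y 2 := congrFun h 2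
    have e3 : x 0 ^ 3 * x 3 = y 0 ^ 3 * y 3 := congrFun h 3
    have e4 : x 0 ^ 2 * x 4 = y 0 ^ 2 * y 4 := congrFun h 4
    have e5 : 1 + x 0 ^ 4 * x 5 = 1 + y 0 ^ 4 * y 5 := congrFun h 5
    rw [h0] at e1 e2 e3 e4 e5
    ext i
    fin_cases i
    · exact h0
    · exact mul_left_cancel₀ (pow_ne_zero 3 hy.ne') e1
    · exact mul_left_cancel₀ (pow_ne_zero 4 hy.ne') (add_left_cancel e2)
    · exact mul_left_cancel₀ (pow_ne_zero 3 hy.ne') e3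
    · exact mul_left_cancel₀ (pow_ne_zero 2 hy.ne') e4
    · exact mul_left_cancel₀ (pow_ne_zero 4 hy.ne') (add_left_cancel e5)
  · rintro y ⟨hy, hyA⟩
    obtain ⟨h4, h1, h0, h2⟩ := (mem_layerEquilibria_iff hA).1 hy
    have hr : 0 < √(A - y 0) := Real.sqrt_pos.2 (by linarith)
    have hr2 : √(A - y 0) ^ 2 = A - y 0 := Real.sq_sqrt (by linarith)
    generalize √(A - y 0) = r at hr hr2
    have hy0 : y 0 = A - r ^ 2 := by linarith
    refine ⟨![r, 0, (y 2 - 1 / A) / r ^ 4, y 3 / r ^ 3, 0, (y 5 - 1) / r ^ 4],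
      ⟨⟨?_, rfl, ?_, rfl⟩, hr⟩, ?_⟩
    · intro h
      have h : r ^ 2 = A := h
      exact h0 (by linarith)
    · rw [hy0] at h0
      simp only [h2, hy0, Fin.isValue, Matrix.cons_val]
      field_simp
      ring
    · ext i
      fin_cases i <;> simp [blowDown, h1, h4, hy0] <;> field_simp <;> ring

/-- On vu² - (B + 1)u + A = 0 the discriminant is (2A/u - (B + 1))², so u is the root with the minus
sign and positive discriminant exactly when u(B + 1) < 2A, for u, v > 0. -/
theorem saddle_iff {B u v : ℝ} (hA : 0 < A) (hB : 0 < B) (hu : u ≠ 0)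
    (hv : v = ((B + 1) * u - A) / u ^ 2) :
    (A / (B + 1) < u ∧ u * (B + 1) < 2 * A) ↔
      0 < v ∧ v < (1 + B) ^ 2 / (4 * A) ∧ u = (1 + B - √((1 + B) ^ 2 - 4 * A * v)) / (2 * v) := by
  have hv' : v * u ^ 2 = (B + 1) * u - A := by
    rw [hv]; field_simp
  constructor
  · rintro ⟨h1, h2⟩
    have hu0 : 0 < u := lt_trans (by positivity) h1
    rw [div_lt_iff₀ (by linarith)] at h1
    have hvpos : 0 < v := by
      rw [hv]
      exact div_pos (by linarith) (by positivity)
    have hD : (1 + B) ^ 2 - 4 * A * v = (2 * A / u - (B + 1)) ^ 2 := by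
      rw [hv]
      field_simp
      ring
    have hpos : 0 < 2 * A / u - (B + 1) := by
      rw [sub_pos, lt_div_iff₀ hu0]
      linarith
    refine ⟨hvpos, ?_, ?_⟩
    · rw [lt_div_iff₀ (by positivity)]
      nlinarith [pow_pos hpos 2]
    · rw [hD, Real.sqrt_sq hpos.le, eq_div_iff (by positivity)]
      field_simp
      linarith
  · rintro ⟨h1, h2, h3⟩
    rw [lt_div_iff₀ (by positivity)] at h2
    have hD : 0 < (1 + B) ^ 2 - 4 * A * v := by linarith
    have hs := Real.sqrt_pos.2 hD
    have hs2 := Real.sq_sqrt hD.le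
    generalize √((1 + B) ^ 2 - 4 * A * v) = s at *
    rw [eq_div_iff (by positivity)] at h3
    -- The rationalized form u = 2A/(1 + B + s) of the root shows both its sign and its upper bound.
    have hAu : 2 * A = u * (1 + B + s) := by
      have : 2 * v * (2 * A - u * (1 + B + s)) = 0 := by
        linear_combination (-1 - B - s) * h3 + hs2
      rcases mul_eq_zero.1 this with h | h
      · exact absurd h (by positivity)
      · linarith
    have hu0 : 0 < u := by
      by_contra hneg
      have : u * (1 + B + s) ≤ 0 := mul_nonpos_of_nonpos_of_nonneg (not_lt.1 hneg) (by positivity)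
      linarith
    refine ⟨?_, ?_⟩
    · rw [div_lt_iff₀ (by positivity)]
      have : 0 < v * u ^ 2 := by positivity
      linarith
    · have : 0 < u * s := by positivity
      linarith

/-- Multiplied by r₁², the numerator of Λ becomes 2A - u(B + 1). -/
theorem Lam_pos_iff (h0 : 0 < x 0) (hu : 0 < A - x 0 ^ 2) :
    0 < Lam A x ↔ (A - x 0 ^ 2) * (1 + x 0 ^ 4 * x 5 + 1) < 2 * A := by
  rw [Lam, div_pos_iff_of_pos_right hu]
  have h2 : 0 < x 0 ^ 2 := by positivity
  rw [← mul_pos_iff_of_pos_left h2]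
  constructor <;> intro h <;> linarith

theorem bijOn_blowDown_criticalManifold (hA : 0 < A) :
    BijOn (blowDown A)
      {x ∈ manifoldV1 A | 0 < x 0 ∧ 0 < 1 + x 0 ^ 4 * x 5 ∧
        A / (2 + x 0 ^ 4 * x 5) < A - x 0 ^ 2}
      {y ∈ criticalManifold A | y 0 < A} := by
  refine bijOn_of_bijOn_of_iff (bijOn_blowDown_layerEquilibria hA) (fun _ h => ⟨h.1, h.2.1⟩) ?_
    fun x hx => ?_
  · rintro y ⟨⟨h4, h5, h1, h2, h0⟩, hyA⟩
    have : 0 < y 0 := lt_trans (by positivity) h0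
    exact ⟨(mem_layerEquilibria_iff hA).2 ⟨h4, h1, this.ne', h2⟩, hyA⟩
  · obtain ⟨hy, hyA⟩ := (bijOn_blowDown_layerEquilibria hA).mapsTo hx
    obtain ⟨h4, h1, h0, h2⟩ := (mem_layerEquilibria_iff hA).1 hy
    have e : (2 : ℝ) + x 0 ^ 4 * x 5 = blowDown A x 5 + 1 := by
      simp only [blowDown, Fin.isValue, Matrix.cons_val]; ring
    constructor
    · rintro ⟨-, -, h5, hlt⟩
      exact ⟨⟨h4, h5, h1, h2, by rw [← e]; exact hlt⟩, hyA⟩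
    · rintro ⟨⟨-, h5, -, -, hlt⟩, -⟩
      exact ⟨hx.1, hx.2, h5, by rw [e]; exact hlt⟩

theorem bijOn_blowDown_saddleSheet (hA : 0 < A) :
    BijOn (blowDown A)
      {x ∈ manifoldV1 A | 0 < x 0 ∧ 0 < 1 + x 0 ^ 4 * x 5 ∧
        A / (2 + x 0 ^ 4 * x 5) < A - x 0 ^ 2 ∧ 0 < Lam A x}
      {y ∈ saddleSheet A | y 0 < A} := by
  refine bijOn_of_bijOn_of_iff (bijOn_blowDown_layerEquilibria hA) (fun _ h => ⟨h.1, h.2.1⟩) ?_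
    fun x hx => ?_
  · rintro y ⟨⟨h4, h5, h1, h2, h2', h0⟩, hyA⟩
    rw [lt_div_iff₀ (by positivity)] at h2'
    have hD : 0 < (1 + y 5) ^ 2 - 4 * A * y 2 := by linarith
    have hs2 := Real.sq_sqrt hD.le
    have hs := Real.sqrt_pos.2 hD
    generalize √((1 + y 5) ^ 2 - 4 * A * y 2) = s at *
    have hne : y 0 ≠ 0 := by
      rw [h0]
      refine div_ne_zero (fun h => ?_) (by positivity)
      have hs' : s = 1 + y 5 := by linarith
      rw [hs'] at hs2
      have : 0 < 4 * A * y 2 := by positivity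
      linarith
    refine ⟨(mem_layerEquilibria_iff hA).2 ⟨h4, h1, hne, ?_⟩, hyA⟩
    rw [eq_div_iff (by positivity)] at h0 ⊢
    have : 4 * y 2 * (y 2 * y 0 ^ 2 - ((y 5 + 1) * y 0 - A)) = 0 := by
      linear_combination (y 0 * (2 * y 2) + 1 + y 5 - s - 2 * (1 + y 5)) * h0 + hs2
    rcases mul_eq_zero.1 this with h | h
    · exact absurd h (by positivity)
    · linarith
  · obtain ⟨hy, hyA⟩ := (bijOn_blowDown_layerEquilibria hA).mapsTo hx
    obtain ⟨h4, h1, h0, h2⟩ := (mem_layerEquilibria_iff hA).1 hy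
    have e : (2 : ℝ) + x 0 ^ 4 * x 5 = blowDown A x 5 + 1 := by
      simp only [blowDown, Fin.isValue, Matrix.cons_val]; ring
    constructor
    · rintro ⟨-, -, h5, hlt, hL⟩
      have hu : 0 < A - x 0 ^ 2 := lt_trans (div_pos hA (by linarith)) hlt
      rw [Lam_pos_iff hx.2 hu] at hL
      rw [e] at hlt
      exact ⟨⟨h4, h5, h1, (saddle_iff hA h5 h0 h2).1 ⟨hlt, hL⟩⟩, hyA⟩
    · rintro ⟨⟨-, h5, -, hs⟩, -⟩
      obtain ⟨hlt, hL⟩ := (saddle_iff hA h5 h0 h2).2 hs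
      have hu : 0 < A - x 0 ^ 2 := lt_trans (by positivity) hlt
      exact ⟨hx.1, hx.2, h5, by rw [e]; exact hlt, (Lam_pos_iff hx.2 hu).2 hL⟩

end

/-! ### The stable and unstable fibers over `𝒱₁` -/

section
variable {A : ℝ} {x : Space6}

/-- The quotient `P₁² / (σ - σ³)²` along the stable fiber. -/
noncomputable def fiberM (A : ℝ) (x : Space6) (σ : ℝ) : ℝ :=
  Lam A x + 2 / 3 * (x 0 ^ 4 * x 2 + 1 / A) * ((σ ^ 2)⁻¹ - 1)

/-- The coordinate `P₁` along the stable fiber. -/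
noncomputable def fiberP (A : ℝ) (x : Space6) (σ : ℝ) : ℝ := (σ - σ ^ 3) * √(fiberM A x σ)

/-- The stable fiber, parametrized by `σ = (V₁ / V₁(x))^(1/4)` or `σ = (ℬ₁ / ℬ₁(x))^(1/4)`. -/
noncomputable def fiberCurve (A : ℝ) (x : Space6) (σ : ℝ) : Space6 :=
  ![x 0 / σ, fiberP A x σ, x 2 * σ ^ 4, x 3 * σ ^ 3, 0, x 5 * σ ^ 4]

/-- The parameters for which the stable fiber is regular. -/
def fiberDomain (A : ℝ) (x : Space6) : Set ℝ := {σ | 0 < σ ∧ 0 < fiberM A x σ}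

theorem fiberM_one (A : ℝ) (x : Space6) : fiberM A x 1 = Lam A x := by simp [fiberM]

theorem fiberP_one (A : ℝ) (x : Space6) : fiberP A x 1 = 0 := by simp [fiberP]

theorem fiberCurve_one (hx : x ∈ manifoldV1 A) : fiberCurve A x 1 = x := by
  ext i
  fin_cases i <;> simp [fiberCurve, fiberP_one, hx.2.1, hx.2.2.2]

theorem one_mem_fiberDomain (hL : 0 < Lam A x) : (1 : ℝ) ∈ fiberDomain A x :=
  ⟨one_pos, by rwa [fiberM_one]⟩

theorem contDiffAt_fiberM {σ : ℝ} (hσ : σ ≠ 0) : ContDiffAt ℝ ∞ (fiberM A x) σ :=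
  contDiffAt_const.add (contDiffAt_const.mul
    (((contDiffAt_id.pow 2).inv (pow_ne_zero 2 hσ)).sub contDiffAt_const))

theorem isOpen_fiberDomain (A : ℝ) (x : Space6) : IsOpen (fiberDomain A x) := by
  rw [isOpen_iff_mem_nhds]
  rintro σ ⟨h0, hM⟩
  filter_upwards [lt_mem_nhds h0,
    (contDiffAt_fiberM h0.ne').continuousAt.eventually_const_lt hM] with τ h1 h2
  exact ⟨h1, h2⟩

theorem contDiffAt_fiberP {σ : ℝ} (hσ : σ ∈ fiberDomain A x) : ContDiffAt ℝ ∞ (fiberP A x) σ :=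
  (contDiffAt_id.sub (contDiffAt_id.pow 3)).mul
    ((contDiffAt_fiberM hσ.1.ne').sqrt hσ.2.ne')

theorem contDiffAt_fiberCurve {σ : ℝ} (hσ : σ ∈ fiberDomain A x) :
    ContDiffAt ℝ ∞ (fiberCurve A x) σ := by
  refine contDiffAt_pi.2 fun i => ?_
  fin_cases i
  · exact contDiffAt_const.div contDiffAt_id hσ.1.ne'
  · exact contDiffAt_fiberP hσ
  · exact contDiffAt_const.mul (contDiffAt_id.pow 4)
  · exact contDiffAt_const.mul (contDiffAt_id.pow 3)
  · exact contDiffAt_const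
  · exact contDiffAt_const.mul (contDiffAt_id.pow 4)

theorem hasDerivAt_fiberP {σ : ℝ} (hσ : σ ∈ fiberDomain A x) :
    HasDerivAt (fiberP A x) ((1 - 3 * σ ^ 2) * √(fiberM A x σ) + (σ - σ ^ 3) *
      (-(4 / 3) * (x 0 ^ 4 * x 2 + 1 / A) / σ ^ 3 / (2 * √(fiberM A x σ)))) σ := by
  have h0 := hσ.1.ne'
  have hM : HasDerivAt (fiberM A x) (-(4 / 3) * (x 0 ^ 4 * x 2 + 1 / A) / σ ^ 3) σ := by
    refine (((((hasDerivAt_id σ).pow 2).inv (pow_ne_zero 2 h0)).sub_const 1).const_mul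
      (2 / 3 * (x 0 ^ 4 * x 2 + 1 / A))).const_add (Lam A x) |>.congr_deriv ?_
    simp
    field_simp
    ring
  refine (((hasDerivAt_id σ).sub ((hasDerivAt_id σ).pow 3)).mul (hM.sqrt hσ.2.ne')).congr_deriv ?_
  simp

theorem deriv_fiberP_one (hL : 0 < Lam A x) : deriv (fiberP A x) 1 = -2 * √(Lam A x) := by
  rw [(hasDerivAt_fiberP (one_mem_fiberDomain hL)).deriv, fiberM_one]
  ring

theorem chartG_fiberCurve (A : ℝ) (x : Space6) (σ : ℝ) : chartG A (fiberCurve A x σ) =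
    x 5 * σ ^ 4 * (A - (x 0 / σ) ^ 2) - x 2 * σ ^ 4 * (A - (x 0 / σ) ^ 2) ^ 2 - 1 / A := by
  rw [chartG_eq]
  rfl

/-- The curve is a trajectory: `P₁` satisfies its equation along it. -/
theorem deriv_fiberP_mul (hA : 0 < A) (hx : x ∈ manifoldV1 A) {σ : ℝ} (hσ : σ ∈ fiberDomain A x) :
    deriv (fiberP A x) σ * (σ * fiberP A x σ / 2) =
      3 / 2 * fiberP A x σ ^ 2 + chartG A (fiberCurve A x σ) := by
  have hV := V_mul_sq hA hx
  have hE := chartGDeriv_eq_Lam hA hx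
  have h0 := hσ.1.ne'
  rw [(hasDerivAt_fiberP hσ).deriv, chartG_fiberCurve]
  have hS := Real.sq_sqrt hσ.2.le
  have hSpos := Real.sqrt_pos.2 hσ.2
  simp only [fiberP]
  generalize √(fiberM A x σ) = S at *
  set d := x 0 ^ 4 * x 2 + 1 / A with hd
  have hM : S ^ 2 * σ ^ 2 = (Lam A x - 2 / 3 * d) * σ ^ 2 + 2 / 3 * d := by
    rw [hS]
    simp only [fiberM, ← hd]
    field_simp
    ring
  -- With a = Aℬ₁ - A²V₁ and c = r₁²(ℬ₁ - 2AV₁), vanishing of G₁ at x gives d = a - c, while Λ = 2a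
  -- - c and G₁ = aσ⁴ - cσ² - d along the curve. Eliminating S² leaves a polynomial identity in a,
  -- c, σ.
  have hda : d = A * x 5 - A ^ 2 * x 2 - x 0 ^ 2 * (x 5 - 2 * A * x 2) := by
    rw [hd]
    linear_combination hV
  have hG : x 5 * σ ^ 4 * (A - (x 0 / σ) ^ 2) - x 2 * σ ^ 4 * (A - (x 0 / σ) ^ 2) ^ 2 - 1 / A =
      (A * x 5 - A ^ 2 * x 2) * σ ^ 4 - x 0 ^ 2 * (x 5 - 2 * A * x 2) * σ ^ 2 - d := by
    rw [hd]
    field_simp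
    ring
  rw [hG]
  have hLa : Lam A x = 2 * (A * x 5 - A ^ 2 * x 2) - x 0 ^ 2 * (x 5 - 2 * A * x 2) := by
    rw [← hE]
    ring
  rw [hLa] at hM
  generalize A * x 5 - A ^ 2 * x 2 = a at *
  generalize x 0 ^ 2 * (x 5 - 2 * A * x 2) = c at *
  clear_value d
  subst hda
  have e1 : ((1 - 3 * σ ^ 2) * S + (σ - σ ^ 3) * (-(4 / 3) * (a - c) / σ ^ 3 / (2 * S))) *
      (σ * ((σ - σ ^ 3) * S) / 2) =
      (1 - 3 * σ ^ 2) * (1 - σ ^ 2) / 2 * (S ^ 2 * σ ^ 2) - (1 - σ ^ 2) ^ 2 * (a - c) / 3 := by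
    field_simp
    ring
  have e2 : 3 / 2 * ((σ - σ ^ 3) * S) ^ 2 = 3 / 2 * (1 - σ ^ 2) ^ 2 * (S ^ 2 * σ ^ 2) := by
    ring
  rw [e1, e2, hM]
  ring

theorem hasDerivAt_fiberCurve {σ : ℝ} (hσ : σ ∈ fiberDomain A x) :
    HasDerivAt (fiberCurve A x) (![-x 0 / σ ^ 2, deriv (fiberP A x) σ, 4 * x 2 * σ ^ 3,
      3 * x 3 * σ ^ 2, 0, 4 * x 5 * σ ^ 3] : Space6) σ := by
  refine hasDerivAt_pi.2 fun i => ?_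
  fin_cases i
  · refine ((hasDerivAt_const σ (x 0)).div (hasDerivAt_id σ) hσ.1.ne').congr_deriv ?_
    simp
  · exact ((contDiffAt_fiberP hσ).differentiableAt (by simp)).hasDerivAt
  · refine (((hasDerivAt_id σ).pow 4).const_mul (x 2)).congr_deriv ?_
    simp
    ring
  · refine (((hasDerivAt_id σ).pow 3).const_mul (x 3)).congr_deriv ?_
    simp
    ring
  · exact hasDerivAt_const _ _
  · refine (((hasDerivAt_id σ).pow 4).const_mul (x 5)).congr_deriv ?_
    simp
    ring

/-- The field is tangent to the curve, so motion along it reduces to the scalar equation σ' =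
σP₁(σ)/2. -/
theorem chartField_fiberCurve (hA : 0 < A) (hx : x ∈ manifoldV1 A) {σ : ℝ}
    (hσ : σ ∈ fiberDomain A x) : chartField A (fiberCurve A x σ) = (σ * fiberP A x σ / 2) •
      (![-x 0 / σ ^ 2, deriv (fiberP A x) σ, 4 * x 2 * σ ^ 3, 3 * x 3 * σ ^ 2, 0,
        4 * x 5 * σ ^ 3] : Space6) := by
  have h := deriv_fiberP_mul hA hx hσ
  have h0 := hσ.1.ne'
  ext i
  fin_cases i
  · simp [chartField, fiberCurve]
    field_simp
  · simp only [chartField, Fin.isValue, Pi.smul_apply, smul_eq_mul]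
    exact h.symm.trans (mul_comm _ _)
  · simp [chartField, fiberCurve]
    ring
  · simp [chartField, fiberCurve]
    ring
  · simp [chartField, fiberCurve]
  · simp [chartField, fiberCurve]
    ring

/-- The parameter of the fiber, as a function of the coordinate `k`. -/
noncomputable def fiberParam (x : Space6) (k : Fin 6) (y : Space6) : ℝ := √√(y k / x k)

theorem continuous_fiberParam (x : Space6) (k : Fin 6) : Continuous (fiberParam x k) :=
  (((continuous_apply k).div_const _).sqrt).sqrt

theorem fiberParam_self {k : Fin 6} (hk : x k ≠ 0) : fiberParam x k x = 1 := by
  simp [fiberParam, div_self hk]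

theorem fiberParam_eq {k : Fin 6} (hk : x k ≠ 0) {y : Space6} {σ : ℝ} (hσ : 0 ≤ σ)
    (hy : y k = x k * σ ^ 4) : fiberParam x k y = σ := by
  rw [fiberParam, hy, mul_div_cancel_left₀ _ hk, show σ ^ 4 = (σ ^ 2) ^ 2 by ring,
    Real.sqrt_sq (sq_nonneg _), Real.sqrt_sq hσ]

theorem div_pos_of_fiberParam_pos {k : Fin 6} {y : Space6} (h : 0 < fiberParam x k y) :
    0 < y k / x k :=
  Real.sqrt_pos.1 (Real.sqrt_pos.1 h)

theorem mul_fiberParam_pow {k : Fin 6} (hk : x k ≠ 0) {y : Space6} (h : 0 < fiberParam x k y) :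
    x k * fiberParam x k y ^ 4 = y k := by
  have h1 := div_pos_of_fiberParam_pos h
  rw [fiberParam, show ∀ a : ℝ, a ^ 4 = (a ^ 2) ^ 2 from fun a => by ring,
    Real.sq_sqrt (Real.sqrt_nonneg _), Real.sq_sqrt h1.le, mul_div_cancel₀ _ hk]

theorem contDiffAt_fiberParam {k : Fin 6} {y : Space6} (h : 0 < fiberParam x k y) :
    ContDiffAt ℝ ∞ (fiberParam x k) y :=
  (((contDiff_apply ℝ ℝ k).contDiffAt.div_const _).sqrt
    (div_pos_of_fiberParam_pos h).ne').sqrt (Real.sqrt_pos.1 h).ne'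

theorem hasDerivWithinAt_fiberParam {k : Fin 6} {γ : ℝ → Space6} {J : Set ℝ} {t p : ℝ}
    (hγ : HasDerivWithinAt (fun t => γ t k) (2 * p * γ t k) J t)
    (h : 0 < fiberParam x k (γ t)) :
    HasDerivWithinAt (fun t => fiberParam x k (γ t)) (p / 2 * fiberParam x k (γ t)) J t := by
  have h1 := div_pos_of_fiberParam_pos h
  have h2 := Real.sqrt_pos.1 h
  refine (((hγ.div_const (x k)).sqrt h1.ne').sqrt h2.ne').congr_deriv ?_
  have e1 := Real.sq_sqrt h1.le
  have e2 := Real.sq_sqrt h2.le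
  have h : 0 < √√(γ t k / x k) := h
  simp only [fiberParam]
  rw [mul_div_assoc (2 * p), div_eq_iff (by positivity), div_eq_iff (by positivity)]
  generalize γ t k / x k = z at *
  generalize √z = s at *
  generalize √s = q at *
  rw [← e1, ← e2]
  ring

theorem hasFDerivAt_fiberParam {k : Fin 6} (hk : x k ≠ 0) : ∃ s' : Space6 →L[ℝ] ℝ,
    HasFDerivAt (fiberParam x k) s' x ∧ ∀ w, s' w = w k / (4 * x k) := by
  have h : 0 < fiberParam x k x := by rw [fiberParam_self hk]; exact one_pos
  have hd := ((contDiffAt_fiberParam h).differentiableAt (by simp)).hasFDerivAt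
  refine ⟨_, hd, fun w => ?_⟩
  have h0 : x + (0 : ℝ) • w = x := by simp
  have h1 : HasDerivAt (fun t : ℝ => fiberParam x k (x + t • w))
      (fderiv ℝ (fiberParam x k) x w) 0 := by
    have hd' : HasFDerivAt (fiberParam x k) (fderiv ℝ (fiberParam x k) x) (x + (0 : ℝ) • w) := by
      rwa [h0]
    exact hd'.comp_hasDerivAt 0 (hasDerivAt_line' x w)
  -- At t = 0 the line satisfies y' = 2py in coordinate k with p = w k / (2 x k), so the rule for
  -- solutions also gives this derivative.
  have h2 : HasDerivWithinAt (fun t : ℝ => fiberParam x k (x + t • w))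
      (w k / (2 * x k) / 2 * fiberParam x k (x + (0 : ℝ) • w)) univ 0 :=
    hasDerivWithinAt_fiberParam (γ := fun t : ℝ => x + t • w)
      ((hasDerivAt_line x w k).hasDerivWithinAt.congr_deriv (by simp; field_simp))
      (by simpa using h)
  rw [hasDerivWithinAt_univ] at h2
  rw [h1.unique h2, h0, fiberParam_self hk]
  field_simp
  norm_num

/-- The parameters near `1` at which the fiber stays `η`-close to `x` and all estimates hold. -/
def IsGoodParam (A : ℝ) (x : Space6) (η σ : ℝ) : Prop :=
  σ ∈ fiberDomain A x ∧ fiberCurve A x σ ∈ Metric.ball x η ∧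
    √(Lam A x) / 2 < 3 / 2 * fiberP A x σ - σ * deriv (fiberP A x) σ / 2 ∧
    √(Lam A x) / 2 < σ ^ 2 * (1 + σ) * √(fiberM A x σ) / 2

theorem continuousAt_deriv_fiberP {σ : ℝ} (hσ : σ ∈ fiberDomain A x) :
    ContinuousAt (deriv (fiberP A x)) σ := by
  have h : ContDiffOn ℝ ∞ (fiberP A x) (fiberDomain A x) := fun τ hτ =>
    (contDiffAt_fiberP hτ).contDiffWithinAt
  exact (h.continuousOn_deriv_of_isOpen (isOpen_fiberDomain A x) (by simp)).continuousAt
    ((isOpen_fiberDomain A x).mem_nhds hσ)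

/-- All conditions are open and hold at σ = 1, where the curve is at x and both quantities compared
with √Λ/2 equal √Λ. -/
theorem eventually_isGoodParam (hx : x ∈ manifoldV1 A) (hL : 0 < Lam A x) {η : ℝ} (hη : 0 < η) :
    ∀ᶠ σ in 𝓝 1, IsGoodParam A x η σ := by
  have h1 := one_mem_fiberDomain hL
  have hs := Real.sqrt_pos.2 hL
  have hc : ContinuousAt (fiberCurve A x) 1 := (contDiffAt_fiberCurve h1).continuousAt
  have hP : ContinuousAt (fiberP A x) 1 := (contDiffAt_fiberP h1).continuousAt
  have hM : ContinuousAt (fiberM A x) 1 := (contDiffAt_fiberM one_ne_zero).continuousAt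
  have c3 : ContinuousAt (fun σ => 3 / 2 * fiberP A x σ - σ * deriv (fiberP A x) σ / 2) 1 :=
    (continuousAt_const.mul hP).sub
      ((continuousAt_id.mul (continuousAt_deriv_fiberP h1)).div_const 2)
  have c4 : ContinuousAt (fun σ : ℝ => σ ^ 2 * (1 + σ) * √(fiberM A x σ) / 2) 1 :=
    ((((continuousAt_id.pow 2).mul (continuousAt_const.add continuousAt_id)).mul hM.sqrt)).div_const
      2
  have c1 : ∀ᶠ σ in 𝓝 1, σ ∈ fiberDomain A x := (isOpen_fiberDomain A x).mem_nhds h1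
  refine c1.and ((hc.eventually
    (Metric.isOpen_ball.mem_nhds ?_)).and ((c3.eventually_const_lt ?_).and
    (c4.eventually_const_lt ?_)))
  · rw [fiberCurve_one hx]
    exact Metric.mem_ball_self hη
  · simp only [fiberP_one, deriv_fiberP_one hL]
    linarith
  · simp only [fiberM_one]
    linarith

/-- The neighbourhoods of `x` in which the fibers are considered. -/
def fiberNhd (x : Space6) (k : Fin 6) (η δ : ℝ) : Set Space6 :=
  Metric.ball x η ∩ {y | |fiberParam x k y - 1| < δ}

theorem isOpen_fiberParam_lt (x : Space6) (k : Fin 6) (δ : ℝ) :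
    IsOpen {y | |fiberParam x k y - 1| < δ} :=
  isOpen_lt ((continuous_fiberParam x k).sub continuous_const).abs continuous_const

theorem fiberCurve_apply {k : Fin 6} (hk : k = 2 ∨ k = 5) (σ : ℝ) :
    fiberCurve A x σ k = x k * σ ^ 4 := by
  rcases hk with rfl | rfl <;> rfl

theorem exists_fiber_solution {η δ : ℝ} (hL : 0 < Lam A x)
    (hgood : ∀ σ, |σ - 1| < δ → IsGoodParam A x η σ) {σ₀ : ℝ} (h0 : |σ₀ - 1| < δ) :
    ∃ (σ : ℝ → ℝ) (δ₁ : ℝ), δ₁ < δ ∧ σ 0 = σ₀ ∧ ∀ t ∈ Ici (0 : ℝ),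
      HasDerivWithinAt σ (σ t * fiberP A x (σ t) / 2) (Ici 0) t ∧ |σ t - 1| < δ₁ ∧
      |σ t - 1| ≤ δ₁ * Real.exp (-(√(Lam A x) / 4) * t) := by
  have hs := Real.sqrt_pos.2 hL
  obtain ⟨δ₁, h01, h1⟩ := exists_between h0
  have hδ₁ : 0 < δ₁ := (abs_nonneg _).trans_lt h01
  set I := Icc (1 - δ₁) (1 + δ₁)
  have hI : ∀ σ ∈ I, |σ - 1| < δ := fun σ hσ =>
    (abs_le.2 ⟨by linarith [hσ.1], by linarith [hσ.2]⟩).trans_lt h1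
  have hfc : ContDiffOn ℝ ∞ (fun σ => σ * fiberP A x σ / 2) I := fun σ hσ =>
    ((contDiffAt_id.mul (contDiffAt_fiberP (hgood σ (hI σ hσ)).1)).div_const 2).contDiffWithinAt
  obtain ⟨K, hK⟩ := hfc.exists_lipschitzOnWith (by simp) (convex_Icc _ _) isCompact_Icc
  obtain ⟨M, hM⟩ := isCompact_Icc.exists_bound_of_continuousOn hfc.continuousOn
  -- Clamping to I makes the scalar field globally Lipschitz; it is never active, because |σ - 1|
  -- stays below δ₁.
  set cl : ℝ → ℝ := fun σ => max (1 - δ₁) (min (1 + δ₁) σ)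
  have hclI : ∀ σ, cl σ ∈ I := fun σ =>
    ⟨le_max_left _ _, max_le (by linarith) (min_le_left _ _)⟩
  have hcl : ∀ σ ∈ I, cl σ = σ := fun σ hσ => by
    simp only [cl]
    rw [min_eq_right hσ.2, max_eq_right hσ.1]
  have hclL : LipschitzWith 1 cl := (LipschitzWith.id.const_min (1 + δ₁)).const_max (1 - δ₁)
  have hF : LipschitzWith K (fun σ => cl σ * fiberP A x (cl σ) / 2) := by
    have := hK.comp hclL.lipschitzOnWith (fun σ (_ : σ ∈ univ) => hclI σ)
    rwa [mul_one, lipschitzOnWith_univ] at this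
  obtain ⟨σ, hσ0, hσ⟩ := exists_solution_Ici_of_lipschitzWith hF (M := M.toNNReal)
    (fun σ => (hM _ (hclI σ)).trans (Real.le_coe_toNNReal M)) σ₀
  have hmem : ∀ t, (σ t - 1) ^ 2 < δ₁ ^ 2 → |σ t - 1| < δ₁ := fun t ht =>
    abs_lt_of_sq_lt_sq ht hδ₁.le
  have hmemI : ∀ t, |σ t - 1| < δ₁ → σ t ∈ I := fun t ht =>
    ⟨by linarith [(abs_lt.1 ht).1], by linarith [(abs_lt.1 ht).2]⟩
  -- The derivative of (σ - 1)² is -σ²(1 + σ)√M (σ - 1)², and the last condition of `IsGoodParam`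
  -- bounds the rate below by √Λ.
  have hdecay := le_mul_exp_of_deriv_le (ℓ := fun t => (σ t - 1) ^ 2) (T := 0) (η := δ₁ ^ 2)
    (c := √(Lam A x)) hs (fun t ht => ((hσ t ht).sub_const 1).pow 2)
    (fun t _ htη => by
      have hg := hgood _ (hI _ (hmemI t (hmem t htη)))
      simp only [hcl _ (hmemI t (hmem t htη)), fiberP]
      have h4 := hg.2.2.2
      have := mul_le_mul_of_nonneg_right h4.le (sq_nonneg (σ t - 1))
      simp only [Nat.cast_ofNat, Nat.add_one_sub_one, pow_one]
      linarith) (sq_nonneg _)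
    (by simp only [hσ0]; exact sq_lt_sq' (by linarith [(abs_lt.1 h01).1]) (abs_lt.1 h01).2)
  refine ⟨σ, δ₁, h1, hσ0, fun t ht => ?_⟩
  obtain ⟨ha, hb⟩ := hdecay t ht
  have hlt := hmem t ha
  refine ⟨?_, hlt, ?_⟩
  · have := hσ t ht
    rwa [hcl _ (hmemI t hlt)] at this
  · refine abs_le_of_sq_le_sq (hb.trans (le_of_eq ?_)) (by positivity)
    rw [mul_pow, ← Real.exp_nat_mul]
    congr 2
    push_cast
    ring

theorem fiberCurve_mem_localStableFiber (hA : 0 < A) (hx : x ∈ manifoldV1 A) (hL : 0 < Lam A x)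
    {k : Fin 6} (hk : k = 2 ∨ k = 5) (hxk : x k ≠ 0) {η δ : ℝ}
    (hgood : ∀ σ, |σ - 1| < δ → IsGoodParam A x η σ) {σ₀ : ℝ} (h0 : |σ₀ - 1| < δ) :
    fiberCurve A x σ₀ ∈ localStableFiber (chartField A) x (fiberNhd x k η δ) := by
  have hs := Real.sqrt_pos.2 hL
  obtain ⟨σ, δ₁, h1, hσ0, hσ⟩ := exists_fiber_solution hL hgood h0
  have hδ₁ : 0 < δ₁ := (abs_nonneg _).trans_lt (hσ 0 self_mem_Ici).2.1
  set I := Icc (1 - δ₁) (1 + δ₁)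
  have hI : ∀ σ ∈ I, |σ - 1| < δ := fun σ hσ =>
    (abs_le.2 ⟨by linarith [hσ.1], by linarith [hσ.2]⟩).trans_lt h1
  have hfc : ContDiffOn ℝ ∞ (fiberCurve A x) I := fun σ hσ =>
    (contDiffAt_fiberCurve (hgood σ (hI σ hσ)).1).contDiffWithinAt
  obtain ⟨K, hK⟩ := hfc.exists_lipschitzOnWith (by simp) (convex_Icc _ _) isCompact_Icc
  -- The decay of σ - 1 passes to the curve with its Lipschitz constant K; the added 1 only keeps
  -- the constant positive.
  refine ⟨fun t => fiberCurve A x (σ t), by simp only [hσ0], fun t ht => ?_, fun t ht => ?_,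
    K * δ₁ + 1, by positivity, √(Lam A x) / 4, by positivity, fun t ht => ?_⟩
  · obtain ⟨hd, hlt, -⟩ := hσ t ht
    have hg := (hgood _ (hlt.trans h1)).1
    rw [chartField_fiberCurve hA hx hg]
    exact (hasDerivAt_fiberCurve hg).scomp_hasDerivWithinAt t hd
  · have hlt := (hσ t ht).2.1.trans h1
    have hg := hgood _ hlt
    refine ⟨hg.2.1, ?_⟩
    rw [mem_ofPred_eq, fiberParam_eq hxk hg.1.1.le (fiberCurve_apply hk _)]
    exact hlt
  · obtain ⟨-, hlt, hle⟩ := hσ t ht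
    have hmem : σ t ∈ I := ⟨by linarith [(abs_lt.1 hlt).1], by linarith [(abs_lt.1 hlt).2]⟩
    have h := hK.dist_le_mul _ hmem 1 ⟨by linarith, by linarith⟩
    rw [fiberCurve_one hx, dist_eq_norm, Real.dist_eq] at h
    have hE := Real.exp_pos (-(√(Lam A x) / 4) * t)
    calc ‖fiberCurve A x (σ t) - x‖ ≤ K * |σ t - 1| := h
      _ ≤ K * (δ₁ * Real.exp (-(√(Lam A x) / 4) * t)) := by gcongr
      _ ≤ (K * δ₁ + 1) * Real.exp (-(√(Lam A x) / 4) * t) := by linarith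

/-- Rigidity: each coordinate minus its value on the curve at parameter s(t) solves a linear
homogeneous equation and tends to 0, hence vanishes (for r₁, the product r₁s is constant). The
exponential rate is used because the coefficients, multiples of P₁, have no definite sign. -/
theorem eq_fiberCurve_of_mem_localStableFiber (hA : 0 < A) (hx : x ∈ manifoldV1 A)
    (hL : 0 < Lam A x) {k : Fin 6} (hk : k = 2 ∨ k = 5) (hxk : x k ≠ 0) {η δ : ℝ}
    (hη : η ≤ √(Lam A x) / 3) (hgood : ∀ σ, |σ - 1| < δ → IsGoodParam A x η σ) {y : Space6}
    (hy : y ∈ localStableFiber (chartField A) x (fiberNhd x k η δ)) :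
    fiberCurve A x (fiberParam x k y) = y := by
  obtain ⟨γ, h0, hγ, hU, C, hC, μ, hμ, hb⟩ := hy
  have hnorm : Tendsto (fun t => ‖γ t - x‖) atTop (𝓝 0) := by
    have h1 : Tendsto (fun t : ℝ => C * Real.exp (-μ * t)) atTop (𝓝 0) := by
      simpa using (Real.tendsto_exp_atBot.comp (tendsto_id.const_mul_atTop_of_neg
        (show -μ < 0 by linarith))).const_mul C
    refine tendsto_of_tendsto_of_tendsto_of_le_of_le' tendsto_const_nhds h1
      (Eventually.of_forall fun t => norm_nonneg _) ?_
    filter_upwards [eventually_ge_atTop 0] with t ht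
    exact hb t ht
  have hlim : Tendsto γ atTop (𝓝 x) := tendsto_iff_norm_sub_tendsto_zero.2 hnorm
  have hl : ∀ i, Tendsto (fun t => γ t i) atTop (𝓝 (x i)) := tendsto_pi_nhds.1 hlim
  have hP : ∀ t ∈ Ici (0 : ℝ), |γ t 1| ≤ C * Real.exp (-μ * t) := fun t ht => by
    have := (norm_le_pi_norm (γ t - x) 1).trans (hb t ht)
    rwa [Pi.sub_apply, hx.2.1, sub_zero, Real.norm_eq_abs] at this
  have hPc : ∀ c : ℝ, ∀ t ∈ Ici (0 : ℝ), |c * γ t 1| ≤ |c| * C * Real.exp (-μ * t) :=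
    fun c t ht => by
      rw [abs_mul, mul_assoc]
      exact mul_le_mul_of_nonneg_left (hP t ht) (abs_nonneg c)
  have z4 : ∀ t ∈ Ici (0 : ℝ), γ t 4 = 0 := eq_zero_of_tendsto_of_exp_small hμ
    (fun t ht => (hγ.coord 4 ht).congr_deriv (by rw [chartField_4]; ring)) hP
    (by simpa [hx.2.2.2] using hl 4)
  have d2 : ∀ t ∈ Ici (0 : ℝ), HasDerivWithinAt (fun t => γ t 2) (2 * γ t 1 * γ t 2) (Ici 0) t :=
    fun t ht => (hγ.coord 2 ht).congr_deriv (by rw [chartField_2, z4 t ht]; ring)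
  have d5 : ∀ t ∈ Ici (0 : ℝ), HasDerivWithinAt (fun t => γ t 5) (2 * γ t 1 * γ t 5) (Ici 0) t :=
    fun t ht => (hγ.coord 5 ht).congr_deriv (by rw [chartField_5]; ring)
  have dk : ∀ t ∈ Ici (0 : ℝ), HasDerivWithinAt (fun t => γ t k) (2 * γ t 1 * γ t k) (Ici 0) t := by
    rcases hk with rfl | rfl
    exacts [d2, d5]
  set s : ℝ → ℝ := fun t => fiberParam x k (γ t) with hs
  have hg : ∀ t ∈ Ici (0 : ℝ), IsGoodParam A x η (s t) := fun t ht => hgood _ (hU t ht).2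
  have hspos : ∀ t ∈ Ici (0 : ℝ), 0 < s t := fun t ht => (hg t ht).1.1
  have ds : ∀ t ∈ Ici (0 : ℝ), HasDerivWithinAt s (γ t 1 / 2 * s t) (Ici 0) t := fun t ht =>
    hasDerivWithinAt_fiberParam (dk t ht) (hspos t ht)
  have hs1 : Tendsto s atTop (𝓝 1) := by
    have := ((continuous_fiberParam x k).tendsto x).comp hlim
    rwa [fiberParam_self hxk] at this
  have e0 : ∀ t ∈ Ici (0 : ℝ), γ t 0 = x 0 / s t := by
    intro t ht
    rw [eq_div_iff (hspos t ht).ne']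
    refine eq_of_tendsto_of_deriv_eq_zero (f := fun t => γ t 0 * s t) (T := 0) (fun u hu => ?_)
      (by simpa using (hl 0).mul hs1) t ht
    refine ((hγ.coord 0 hu).mul (ds u hu)).congr_deriv ?_
    rw [chartField_0]
    ring
  have e2 : ∀ t ∈ Ici (0 : ℝ), γ t 2 - x 2 * s t ^ 4 = 0 :=
    eq_zero_of_tendsto_of_exp_small (P := fun t => 2 * γ t 1) hμ
      (fun t ht => ((d2 t ht).sub (((ds t ht).pow 4).const_mul (x 2))).congr_deriv
        (by simp; ring)) (hPc 2) (by simpa using (hl 2).sub ((hs1.pow 4).const_mul (x 2)))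
  have e5 : ∀ t ∈ Ici (0 : ℝ), γ t 5 - x 5 * s t ^ 4 = 0 :=
    eq_zero_of_tendsto_of_exp_small (P := fun t => 2 * γ t 1) hμ
      (fun t ht => ((d5 t ht).sub (((ds t ht).pow 4).const_mul (x 5))).congr_deriv
        (by simp; ring)) (hPc 2) (by simpa using (hl 5).sub ((hs1.pow 4).const_mul (x 5)))
  have e3 : ∀ t ∈ Ici (0 : ℝ), γ t 3 - x 3 * s t ^ 3 = 0 :=
    eq_zero_of_tendsto_of_exp_small (P := fun t => 3 / 2 * γ t 1) hμ
      (fun t ht => ((hγ.coord 3 ht).sub (((ds t ht).pow 3).const_mul (x 3))).congr_deriv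
        (by rw [chartField_3, z4 t ht]; simp; ring)) (hPc (3 / 2))
      (by simpa using (hl 3).sub ((hs1.pow 3).const_mul (x 3)))
  have eG : ∀ t ∈ Ici (0 : ℝ), chartG A (γ t) = chartG A (fiberCurve A x (s t)) := fun t ht => by
    rw [chartG_fiberCurve, chartG_eq, e0 t ht, sub_eq_zero.1 (e2 t ht), sub_eq_zero.1 (e5 t ht)]
  have hsc : ContinuousOn s (Ici 0) := fun t ht => (ds t ht).continuousWithinAt
  have hPs : ContinuousOn (fun t => fiberP A x (s t)) (Ici 0) := fun t ht =>
    (contDiffAt_fiberP (hg t ht).1).continuousAt.comp_continuousWithinAt (hsc t ht)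
  have hPs' : ContinuousOn (fun t => deriv (fiberP A x) (s t)) (Ici 0) := fun t ht =>
    (continuousAt_deriv_fiberP (hg t ht).1).comp_continuousWithinAt (hsc t ht)
  -- Subtracting the P₁-equation of the curve leaves a coefficient that is positive: in U one has
  -- |P₁| < η ≤ √Λ/3, so (3/2)P₁ > -√Λ/2, and the third condition of `IsGoodParam` supplies the
  -- rest.
  have e1 : ∀ t ∈ Ici (0 : ℝ), γ t 1 - fiberP A x (s t) = 0 := by
    refine eq_zero_of_tendsto_of_eventually_nonneg
      (c := fun t => 3 / 2 * (γ t 1 + fiberP A x (s t)) - s t * deriv (fiberP A x) (s t) / 2)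
      (fun t ht => ?_) ?_ ?_ ?_
    · have hd := ((contDiffAt_fiberP (hg t ht).1).differentiableAt
        (by simp)).hasDerivAt.comp_hasDerivWithinAt t (ds t ht)
      refine ((hγ.coord 1 ht).sub hd).congr_deriv ?_
      rw [chartField_1, eG t ht]
      linear_combination -deriv_fiberP_mul hA hx (hg t ht).1
    · exact (continuousOn_const.mul ((hγ.continuousOn_coord 1).add hPs)).sub
        ((hsc.mul hPs').div_const 2)
    · filter_upwards [eventually_ge_atTop 0] with t ht
      have h3 := (hg t ht).2.2.1
      have hball := (norm_le_pi_norm (γ t - x) 1).trans_lt (mem_ball_iff_norm.1 (hU t ht).1)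
      rw [Pi.sub_apply, hx.2.1, sub_zero, Real.norm_eq_abs] at hball
      have := (abs_lt.1 hball).1
      linarith
    · have h1 := ((contDiffAt_fiberP (one_mem_fiberDomain hL)).continuousAt.tendsto).comp hs1
      rw [fiberP_one] at h1
      simpa [hx.2.1] using (hl 1).sub h1
  have h00 : (0 : ℝ) ∈ Ici (0 : ℝ) := self_mem_Ici
  have hsy : s 0 = fiberParam x k y := by rw [hs]; simp only [h0]
  rw [← hsy, ← h0]
  ext i
  fin_cases i
  exacts [(e0 0 h00).symm, (sub_eq_zero.1 (e1 0 h00)).symm, (sub_eq_zero.1 (e2 0 h00)).symm,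
    (sub_eq_zero.1 (e3 0 h00)).symm, (z4 0 h00).symm, (sub_eq_zero.1 (e5 0 h00)).symm]

theorem localStableFiber_fiberNhd (hA : 0 < A) (hx : x ∈ manifoldV1 A)
    (hL : 0 < Lam A x) {k : Fin 6} (hk : k = 2 ∨ k = 5) (hxk : x k ≠ 0) {η δ : ℝ}
    (hη : η ≤ √(Lam A x) / 3) (hgood : ∀ σ, |σ - 1| < δ → IsGoodParam A x η σ) :
    localStableFiber (chartField A) x (fiberNhd x k η δ) =
      {y | y ∈ {y | |fiberParam x k y - 1| < δ} ∧ fiberCurve A x (fiberParam x k y) = y} := by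
  ext y
  constructor
  · intro hy
    refine ⟨?_, eq_fiberCurve_of_mem_localStableFiber hA hx hL hk hxk hη hgood hy⟩
    obtain ⟨γ, h0, -, hU, -⟩ := hy
    rw [← h0]
    exact (hU 0 self_mem_Ici).2
  · rintro ⟨hy, hfy⟩
    rw [← hfy]
    exact fiberCurve_mem_localStableFiber hA hx hL hk hxk hgood hy

theorem localStableFiber_properties (hA : 0 < A) (hx : x ∈ manifoldV1 A)
    (hL : 0 < Lam A x) {k : Fin 6} (hk : k = 2 ∨ k = 5) (hxk : x k ≠ 0) {η δ : ℝ}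
    (hη : η ≤ √(Lam A x) / 3) (hδ : 0 < δ) (hgood : ∀ σ, |σ - 1| < δ → IsGoodParam A x η σ) :
    x ∈ localStableFiber (chartField A) x (fiberNhd x k η δ) ∧
      IsSmoothSubmanifold 1 (localStableFiber (chartField A) x (fiberNhd x k η δ)) ∧
      tangentVectors (localStableFiber (chartField A) x (fiberNhd x k η δ)) x =
        (jacobian (chartField A) x).eigenspace (-√(Lam A x)) := by
  have hs := Real.sqrt_pos.2 hL
  have hfs : ∀ y z : Space6, (∀ i ∈ ({k} : Finset (Fin 6)), y i = z i) →
      fiberParam x k y = fiberParam x k z := fun y z h => by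
    simp only [fiberParam, h k (by simp)]
  have hfs' : ∀ y z : Space6, (∀ i ∈ ({k} : Finset (Fin 6)), y i = z i) →
      fiberCurve A x (fiberParam x k y) = fiberCurve A x (fiberParam x k z) := fun y z h => by
    rw [hfs y z h]
  have hOs : ∀ y z : Space6, (∀ i ∈ ({k} : Finset (Fin 6)), y i = z i) →
      y ∈ {y | |fiberParam x k y - 1| < δ} → z ∈ {y | |fiberParam x k y - 1| < δ} :=
    fun y z h hy => by
      rw [mem_ofPred_eq] at hy ⊢
      rwa [← hfs y z h]
  have hid : ∀ y ∈ {y | |fiberParam x k y - 1| < δ}, ∀ i ∈ ({k} : Finset (Fin 6)),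
      fiberCurve A x (fiberParam x k y) i = y i := fun y hy i hi => by
    rw [Finset.mem_singleton.1 hi, fiberCurve_apply hk, mul_fiberParam_pow hxk (hgood _ hy).1.1]
  have hxO : x ∈ {y | |fiberParam x k y - 1| < δ} := by
    rw [mem_ofPred_eq, fiberParam_self hxk]
    simpa using hδ
  have hfx : fiberCurve A x (fiberParam x k x) = x := by
    rw [fiberParam_self hxk, fiberCurve_one hx]
  rw [localStableFiber_fiberNhd hA hx hL hk hxk hη hgood]
  refine ⟨⟨hxO, hfx⟩, ?_, ?_⟩
  · refine isSmoothSubmanifold_graph (s := {k}) (isOpen_fiberParam_lt x k δ) (fun y hy => ?_) hfs'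
      hOs hid ⟨x, hxO, hfx⟩
    have hg := (hgood _ hy).1
    exact ((contDiffAt_fiberCurve hg).comp y (contDiffAt_fiberParam hg.1)).contDiffWithinAt
  · obtain ⟨s', hs', hs'w⟩ := hasFDerivAt_fiberParam hxk
    have h1 := one_mem_fiberDomain hL
    have hc := hasDerivAt_fiberCurve h1
    rw [← fiberParam_self hxk] at hc
    have hf : HasFDerivAt (fun y => fiberCurve A x (fiberParam x k y)) _ x :=
      hc.hasFDerivAt.comp x hs'
    rw [tangentVectors_graph (isOpen_fiberParam_lt x k δ) hfs' hOs hid hxO hfx hf]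
    ext w
    rw [SetLike.mem_coe, mem_eigenspace_iff_exists hA hx (neg_ne_zero.2 hs.ne')
      (by rw [neg_sq, Real.sq_sqrt hL.le])]
    have hv : (![-x 0 / fiberParam x k x ^ 2, deriv (fiberP A x) (fiberParam x k x),
        4 * x 2 * fiberParam x k x ^ 3, 3 * x 3 * fiberParam x k x ^ 2, 0,
        4 * x 5 * fiberParam x k x ^ 3] : Space6) =
        (2 : ℝ) • ![-(1 / 2) * x 0, -√(Lam A x), 2 * x 2, 3 / 2 * x 3, 0, 2 * x 5] := by
      rw [fiberParam_self hxk, deriv_fiberP_one hL]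
      ext i
      fin_cases i <;> simp <;> ring
    -- The nonzero k-th entry normalizes the eigenvector: the derivative of the parametrization
    -- sends w to (w k / (2 x k)) v, which fixes every multiple of v.
    have hvk : (![-(1 / 2) * x 0, -√(Lam A x), 2 * x 2, 3 / 2 * x 3, 0, 2 * x 5] : Space6) k =
        2 * x k := by
      rcases hk with rfl | rfl <;> rfl
    rw [hv]
    generalize (![-(1 / 2) * x 0, -√(Lam A x), 2 * x 2, 3 / 2 * x 3, 0, 2 * x 5] : Space6) = v at *
    simp only [mem_ofPred_eq, ContinuousLinearMap.comp_apply,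
      ContinuousLinearMap.toSpanSingleton_apply, hs'w, smul_smul]
    constructor
    · exact fun h => ⟨_, h.symm⟩
    · rintro ⟨a, rfl⟩
      congr 1
      rw [Pi.smul_apply, hvk, smul_eq_mul]
      field_simp
      norm_num

theorem reflection_mem_manifoldV1 (hx : x ∈ manifoldV1 A) : reflection x ∈ manifoldV1 A :=
  ⟨hx.1, by simp [reflection, hx.2.1], hx.2.2.1, hx.2.2.2⟩

theorem exists_fiberNhd (hA : 0 < A) (hx : x ∈ manifoldV1 A) (hL : 0 < Lam A x) {N : Set Space6}
    (hN : N ∈ 𝓝 x) : ∃ U ⊆ N, IsOpen U ∧ x ∈ U ∧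
      (x ∈ localStableFiber (chartField A) x U ∧
        IsSmoothSubmanifold 1 (localStableFiber (chartField A) x U) ∧
        tangentVectors (localStableFiber (chartField A) x U) x =
          (jacobian (chartField A) x).eigenspace (-√(Lam A x))) ∧
      (x ∈ localUnstableFiber (chartField A) x U ∧
        IsSmoothSubmanifold 1 (localUnstableFiber (chartField A) x U) ∧
        tangentVectors (localUnstableFiber (chartField A) x U) x =
          (jacobian (chartField A) x).eigenspace (√(Lam A x))) := by
  have hs := Real.sqrt_pos.2 hL
  have hRx := reflection_mem_manifoldV1 hx
  have hRL : Lam A (reflection x) = Lam A x := rfl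
  -- V₁ and ℬ₁ cannot both vanish on 𝒱₁, since V₁u² = ℬ₁u - 1/A; either one that is nonzero can
  -- parametrize the fiber.
  obtain ⟨k, hk, hxk⟩ : ∃ k : Fin 6, (k = 2 ∨ k = 5) ∧ x k ≠ 0 := by
    by_cases h5 : x 5 = 0
    · refine ⟨2, Or.inl rfl, fun h2 => ?_⟩
      have := V_mul_sq hA hx
      rw [h2, h5] at this
      have hpos : 0 < 1 / A := by positivity
      linarith
    · exact ⟨5, Or.inr rfl, h5⟩
  have hRk : ∀ y : Space6, reflection y k = y k := fun y => by rcases hk with rfl | rfl <;> rfl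
  obtain ⟨η₀, hη₀, hball⟩ := Metric.mem_nhds_iff.1 hN
  set η := min η₀ (√(Lam A x) / 3)
  have hη : 0 < η := lt_min hη₀ (by positivity)
  -- One δ serves x and its mirror image, so that a single U works for the stable and the unstable
  -- fiber.
  obtain ⟨δ, hδ, hgood⟩ := Metric.eventually_nhds_iff.1 ((eventually_isGoodParam hx hL hη).and
    (eventually_isGoodParam hRx (hRL ▸ hL) hη))
  have hst := localStableFiber_properties (η := η) hA hx hL hk hxk (min_le_right _ _) hδ
    (fun σ hσ => (hgood (by rwa [Real.dist_eq])).1)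
  have hun := localStableFiber_properties (η := η) hA hRx (hRL ▸ hL) hk
    (by rwa [hRk]) (min_le_right _ _) hδ
    (fun σ hσ => (hgood (by rwa [Real.dist_eq])).2)
  have hU : fiberNhd (reflection x) k η δ = reflectionEquiv ⁻¹' fiberNhd x k η δ := by
    ext y
    have h1 : ‖y - reflection x‖ = ‖reflection y - x‖ := by
      rw [← norm_reflection (y - reflection x), ← coe_reflectionEquiv, map_sub,
        coe_reflectionEquiv, coe_reflectionEquiv, reflection_reflection]
    simp only [fiberNhd, mem_inter_iff, mem_preimage, mem_ball_iff_norm, mem_ofPred_eq, fiberParam,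
      coe_reflectionEquiv, hRk, h1]
  have hunst : localUnstableFiber (chartField A) x (fiberNhd x k η δ) = reflectionEquiv ⁻¹'
      localStableFiber (chartField A) (reflection x) (fiberNhd (reflection x) k η δ) := by
    rw [hU]
    exact localUnstableFiber_eq_preimage (R := reflectionEquiv) (chartField_reflection A)
      reflection_reflection norm_reflection _ _
  refine ⟨fiberNhd x k η δ, inter_subset_left.trans
    ((Metric.ball_subset_ball (min_le_left _ _)).trans hball),
    Metric.isOpen_ball.inter (isOpen_fiberParam_lt x k δ), ⟨Metric.mem_ball_self hη, ?_⟩, hst, ?_⟩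
  · rw [mem_ofPred_eq, fiberParam_self hxk]
    simpa using hδ
  · rw [hunst, tangentVectors_preimage]
    refine ⟨hun.1, hun.2.1.preimage _, ?_⟩
    rw [coe_reflectionEquiv, hun.2.2]
    ext w
    rw [mem_preimage, SetLike.mem_coe, SetLike.mem_coe, hRL,
      mem_eigenspace_iff_exists hA hRx (neg_ne_zero.2 hs.ne')
        (by rw [neg_sq, Real.sq_sqrt hL.le, hRL]),
      mem_eigenspace_iff_exists hA hx hs.ne' (Real.sq_sqrt hL.le)]
    have hv : reflectionEquiv ![-(1 / 2) * x 0, √(Lam A x), 2 * x 2, 3 / 2 * x 3, 0, 2 * x 5] =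
        ![-(1 / 2) * reflection x 0, -√(Lam A x), 2 * reflection x 2, 3 / 2 * reflection x 3, 0,
          2 * reflection x 5] := by
      rw [coe_reflectionEquiv]
      ext i
      fin_cases i <;> simp [reflection]
    rw [← hv]
    constructor
    · rintro ⟨a, h⟩
      exact ⟨a, reflectionEquiv.injective (by rw [h, map_smul])⟩
    · rintro ⟨a, rfl⟩
      exact ⟨a, map_smul _ _ _⟩

end

theorem mainTheorem5 (A : ℝ) (hA : 0 < A) :
    -- 1. The symmetric isolated equilibria on the invariant line
    (IsIsolatedEquilibrium (chartField A) (Eplus A) ∧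
      IsIsolatedEquilibrium (chartField A) (Eminus A) ∧
      Eplus A ≠ Eminus A ∧ reflection (Eplus A) = Eminus A ∧
      (∀ x, chartField A (reflection x) = -reflection (chartField A x)) ∧
      Eplus A ∈ lineI ∧ Eminus A ∈ lineI ∧ IsInvariantSet (chartField A) lineI) ∧
    -- the dimensions of their stable and unstable manifolds
    (IsSmoothSubmanifold 1 (stableManifold (chartField A) (Eplus A)) ∧
      IsSmoothSubmanifold 5 (unstableManifold (chartField A) (Eplus A)) ∧
      IsSmoothSubmanifold 1 (unstableManifold (chartField A) (Eminus A)) ∧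
      IsSmoothSubmanifold 5 (stableManifold (chartField A) (Eminus A))) ∧
    -- 2. The three-dimensional manifold of equilibria
    (IsSmoothSubmanifold 3 (manifoldV1 A) ∧ (∀ x ∈ manifoldV1 A, chartField A x = 0)) ∧
    -- it contains the line `ℓ₁`
    (lineL1 A ⊆ manifoldV1 A ∧ lineL1 A = {x ∈ manifoldV1 A | x 0 = 0 ∧ x 5 = 0}) ∧
    -- it is the part with `u < A` of the critical manifold, expressed in the chart
    (BijOn (blowDown A) {x ∈ manifoldV1 A | 0 < x 0} {y ∈ layerEquilibria A | y 0 < A} ∧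
      BijOn (blowDown A)
        {x ∈ manifoldV1 A | 0 < x 0 ∧ 0 < 1 + x 0 ^ 4 * x 5 ∧
          A / (2 + x 0 ^ 4 * x 5) < A - x 0 ^ 2}
        {y ∈ criticalManifold A | y 0 < A} ∧
      BijOn (blowDown A)
        {x ∈ manifoldV1 A | 0 < x 0 ∧ 0 < 1 + x 0 ^ 4 * x 5 ∧
          A / (2 + x 0 ^ 4 * x 5) < A - x 0 ^ 2 ∧ 0 < Lam A x}
        {y ∈ saddleSheet A | y 0 < A}) ∧
    -- the real eigenvalues of the linearization on it are `0` and, where `Λ > 0`, `±√Λ`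
    (∀ x ∈ manifoldV1 A, ∀ μ : ℝ,
      (jacobian (chartField A) x).HasEigenvalue μ ↔ μ = 0 ∨ μ ^ 2 = Lam A x) ∧
    -- one-dimensional stable and unstable fibers over the points with `Λ > 0`
    (∀ x ∈ manifoldV1 A, 0 < Lam A x → ∀ N ∈ 𝓝 x, ∃ U ⊆ N, IsOpen U ∧ x ∈ U ∧
      (x ∈ localStableFiber (chartField A) x U ∧
        IsSmoothSubmanifold 1 (localStableFiber (chartField A) x U) ∧
        tangentVectors (localStableFiber (chartField A) x U) x =
          (jacobian (chartField A) x).eigenspace (-√(Lam A x))) ∧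
      (x ∈ localUnstableFiber (chartField A) x U ∧
        IsSmoothSubmanifold 1 (localUnstableFiber (chartField A) x U) ∧
        tangentVectors (localUnstableFiber (chartField A) x U) x =
          (jacobian (chartField A) x).eigenspace (√(Lam A x)))) ∧
    -- the one-dimensional neutral fiber over the points with `Λ ≠ 0`
    (∀ x ∈ manifoldV1 A, Lam A x ≠ 0 → ∃ T : Submodule ℝ Space6,
      (T : Set Space6) = tangentVectors (manifoldV1 A) x ∧ Module.finrank ℝ T = 3 ∧
      T ≤ LinearMap.ker (jacobian (chartField A) x) ∧
      Module.finrank ℝ (neutralFiber A x) = 1 ∧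
      T ⊓ neutralFiber A x = ⊥ ∧
      T ⊔ neutralFiber A x = (jacobian (chartField A) x).maxGenEigenspace 0 ∧
      -- the linearized flow on the fiber is affine in time
      (∀ w ∈ neutralFiber A x, ∀ t : ℝ,
        NormedSpace.exp (t • fderiv ℝ (chartField A) x) w = w + t • fderiv ℝ (chartField A) x w) ∧
      -- the fiber belongs to nontrivial Jordan blocks, except over the points `p₊` and `p₋`
      (∀ w ∈ neutralFiber A x, jacobian (chartField A) x w ∈ T) ∧
      (x ≠ pointP A 1 → x ≠ pointP A (-1) →
        LinearMap.ker (jacobian (chartField A) x) = T ∧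
        ∀ w ∈ neutralFiber A x, w ≠ 0 → jacobian (chartField A) x w ≠ 0) ∧
      (x = pointP A 1 ∨ x = pointP A (-1) →
        LinearMap.ker (jacobian (chartField A) x) = T ⊔ neutralFiber A x)) := by
  refine ⟨⟨?_, ?_, ?_, reflection_Eplus A, chartField_reflection A, Eplus_mem_lineI A,
    Eminus_mem_lineI A, isInvariantSet_lineI A⟩, isSmoothSubmanifold_invariantManifolds hA,
    ⟨isSmoothSubmanifold_manifoldV1 hA, fun x hx => chartField_eq_zero hA hx⟩,
    ⟨lineL1_subset hA, lineL1_eq hA⟩, ⟨bijOn_blowDown_layerEquilibria hA,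
      bijOn_blowDown_criticalManifold hA, bijOn_blowDown_saddleSheet hA⟩,
    fun x hx => hasEigenvalue_iff hA hx, fun x hx hL N hN => exists_fiberNhd hA hx hL hN,
    fun x hx hL => ?_⟩
  · exact isIsolatedEquilibrium_chartField hA (Eplus_mem_lineI A) rfl
  · exact isIsolatedEquilibrium_chartField hA (Eminus_mem_lineI A) (by simp [Eminus])
  · intro h
    have h1 : rho A = -rho A := congrFun h 1
    have := rho_pos hA
    linarith
  · refine ⟨tangentV1 A x, coe_tangentV1 hA hx, finrank_tangentV1 hx, tangentV1_le_ker hA hx,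
      finrank_neutralFiber hL, tangentV1_inf_neutralFiber hL, tangent_sup_neutral_eq hA hx hL,
      fun w hw t => ?_, fun w hw => jacobian_neutral_mem hA hx hw, fun h1 h2 => ?_, fun h => ?_⟩
    · exact exp_smul_apply_of_sq_eq_zero _
        (tangentV1_le_ker hA hx (jacobian_neutral_mem hA hx hw)) t
    · have hker : LinearMap.ker (jacobian (chartField A) x) = tangentV1 A x := by
        refine le_antisymm (fun w hw => ?_) (tangentV1_le_ker hA hx)
        by_contra hT
        rcases eq_pointP_of_mem_ker hA hx hw hT with h | h
        exacts [h1 h, h2 h]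
      refine ⟨hker, fun w hw hw0 h => hw0 ?_⟩
      have hmem : w ∈ tangentV1 A x ⊓ neutralFiber A x := ⟨hker ▸ LinearMap.mem_ker.2 h, hw⟩
      rwa [tangentV1_inf_neutralFiber hL, Submodule.mem_bot] at hmem
    · refine le_antisymm (fun w hw => ?_) (sup_le (tangentV1_le_ker hA hx) ?_)
      · rw [tangent_sup_neutral_eq hA hx hL]
        exact (Module.End.mem_maxGenEigenspace _ _ _).2
          ⟨1, by simpa using hw⟩
      · rcases h with rfl | rfl
        · exact neutralFiber_le_ker_pointP hA (one_pow 2)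
        · exact neutralFiber_le_ker_pointP hA (by norm_num)
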